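/- All sheaves are sheaves of abelian groups; for a topological space $X$ let $\operatorname{Sh}(X)$ be the abelian category of sheaves on $X$ and $D^+(X)$ its bounded below derived category. A map is *proper* if it is continuous and universally closed. A continuous map $f\colon Y\to X$ is *separated* if the diagonal is closed in $Y\times_X Y$; it is *locally proper* if for every $y\in Y$ and every neighborhood $V$ of $y$ there are neighborhoods $A\subset V$ of $y$ and $U$ of $f(y)$ such that $f(A)\subset U$ and the induced map $f\colon A\to U$ is proper. For continuous $f\colon Y\to X$ write $f^{(*)}$ and $f_{(*)}$ for the inverse and direct image functors of sheaves, and let $f_{(!)}\colon\operatorname{Sh}(Y)\to\operatorname{Sh}(X)$ be the proper direct image, i.e. the left exact subfunctor of $f_{(*)}$ given by $$(f_{(!)}\mathcal F)(U)=\{s\in\mathcal F(f^{-1}(U)) \mid f\colon \operatorname{supp}s\to U \text{ is proper}\}.$$ Write $f^*$ and $f_!$ for the derived functors of $f^{(*)}$ and $f_{(!)}$ on $D^+$, and $\mathrm R$ for right derived functors on $D^+$. Let $$\begin{array}{ccc} W & \xrightarrow{\ q\ } & Y\\ {\scriptstyle g}\downarrow & & \downarrow{\scriptstyle f}\\ Z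 & \xrightarrow{\ p\ } & X\end{array}$$ be a cartesian diagram of topological spaces and continuous maps. The identity $f_{(*)}q_{(*)}=p_{(*)}g_{(*)}$ restricts to a morphism $f_{(!)}q_{(*)}\to p_{(*)}g_{(!)}$, and by adjunction the composition $f_{(!)}\to f_{(!)}q_{(*)}q^{(*)}\to p_{(*)}g_{(!)}q^{(*)}$ yields the base change morphism $\beta\colon p^{(*)}\circ f_{(!)}\to g_{(!)}\circ q^{(*)}$. **Theorem (Derived proper base change).** Assume that $f$ and $g$ are separated and locally proper. Then the canonical morphisms $$\mathrm R(p^{(*)}\circ f_{(!)})\to p^*\circ f_!,\qquad \mathrm R(g_{(!)}\circ q^{(*)})\to g_!\circ q^*$$ are isomorphisms of triangulated functors $D^+(Y)\to D^+(Z)$, and there is an isomorphism of triangulated functors $$p^*\circ f_!\xrightarrow{\ \sim\ } g_!\circ q^*$$ whose composition with $\mathrm R(p^{(*)}\circ f_{(!)})\to p^*\circ f_!$ is equal to the composition $$\mathrm R(p^{(*)}\circ f_{(!)})\xrightarrow{\mathrm R\beta}\mathrm R(g_{(!)}\circ q^{(*)})\to g_!\circ q^*.$$ -/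

import Mathlib

open CategoryTheory Limits TopologicalSpace Opposite Topology Filter

universe u w₁ w₂ w₃ w₄

/-- `f` maps `A` into `U` and the induced map `A → U` of subspaces is proper. -/
def ProperOver {Y X : Type*} [TopologicalSpace Y] [TopologicalSpace X]
    (f : Y → X) (A : Set Y) (U : Set X) : Prop :=
  ∃ h : Set.MapsTo f A U, IsProperMap (h.restrict f A U)

/-- Locally proper maps of topological spaces. -/
def IsLocallyProper {Y X : Type*} [TopologicalSpace Y] [TopologicalSpace X]
    (f : Y → X) : Prop :=
  Continuous f ∧ ∀ y : Y, ∀ V ∈ 𝓝 y, ∃ A ∈ 𝓝 y, ∃ U ∈ 𝓝 (f y), A ⊆ V ∧ ProperOver f A U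

lemma properOver_iff {Y X : Type*} [TopologicalSpace Y] [TopologicalSpace X]
    {f : Y → X} (hf : Continuous f) {A : Set Y} {U : Set X} :
    ProperOver f A U ↔ Set.MapsTo f A U ∧ ∀ 𝒰 : Ultrafilter Y, A ∈ 𝒰 → ∀ x ∈ U,
      Tendsto f 𝒰 (𝓝 x) → ∃ y ∈ A, f y = x ∧ (𝒰 : Filter Y) ≤ 𝓝 y := by
  constructor
  · rintro ⟨h, hp⟩
    refine ⟨h, fun 𝒰 hA x hx ht => ?_⟩
    have hp' := (isProperMap_iff_ultrafilter.1 hp).2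
    let 𝒱 : Ultrafilter A := 𝒰.comap Subtype.val_injective (by simpa using hA)
    have h𝒱 : Filter.map (Subtype.val : A → Y) 𝒱 = 𝒰 := by
      have : (𝒱 : Filter A) = Filter.comap Subtype.val 𝒰 := Ultrafilter.coe_comap _ _ _
      rw [this, Filter.map_comap_of_mem (by simpa using hA)]
    obtain ⟨a, ha, hle⟩ := hp' (𝒰 := 𝒱) (y := ⟨x, hx⟩) (by
      rw [tendsto_subtype_rng]
      have : Tendsto (f ∘ (Subtype.val : A → Y)) 𝒱 (𝓝 x) := by
        rw [← Filter.tendsto_map'_iff, h𝒱]; exact ht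
      exact this)
    refine ⟨a, a.2, congrArg Subtype.val ha, ?_⟩
    rw [← h𝒱]
    exact (Filter.map_mono hle).trans (continuous_subtype_val.tendsto a)
  · rintro ⟨h, hp⟩
    refine ⟨h, isProperMap_iff_ultrafilter.2 ⟨hf.restrict h, fun 𝒱 x ht => ?_⟩⟩
    obtain ⟨y, hy, hyx, hle⟩ := hp (𝒱.map Subtype.val)
      (by
        change Subtype.val ⁻¹' A ∈ 𝒱
        rw [Subtype.coe_preimage_self]
        exact univ_mem) x.1 x.2
      (by
        have := (continuous_subtype_val.tendsto x).comp ht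
        rw [Ultrafilter.coe_map, Filter.tendsto_map'_iff]
        exact this)
    refine ⟨⟨y, hy⟩, Subtype.ext hyx, ?_⟩
    rw [nhds_subtype, ← Filter.map_le_iff_le_comap]
    exact hle

lemma ProperOver.mono {Y X : Type*} [TopologicalSpace Y] [TopologicalSpace X]
    {f : Y → X} (hf : Continuous f) {A B : Set Y} {U V : Set X}
    (h : ProperOver f A U) (hBA : B ⊆ A) (hVU : V ⊆ U) (hBV : Set.MapsTo f B V)
    (hcl : ∀ y ∈ A, f y ∈ V → y ∉ B → Bᶜ ∈ 𝓝 y) : ProperOver f B V := by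
  rw [properOver_iff hf] at h ⊢
  refine ⟨hBV, fun 𝒰 hB x hx ht => ?_⟩
  obtain ⟨y, hy, rfl, hle⟩ := h.2 𝒰 (mem_of_superset hB hBA) x (hVU hx) ht
  refine ⟨y, ?_, rfl, hle⟩
  by_contra hyB
  exact 𝒰.compl_mem_iff_notMem.1 (hle (hcl y hy hx hyB)) hB

lemma ProperOver.union {Y X : Type*} [TopologicalSpace Y] [TopologicalSpace X]
    {f : Y → X} (hf : Continuous f) {A B : Set Y} {U : Set X}
    (hA : ProperOver f A U) (hB : ProperOver f B U) : ProperOver f (A ∪ B) U := by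
  rw [properOver_iff hf] at hA hB ⊢
  refine ⟨hA.1.union hB.1, fun 𝒰 h x hx ht => ?_⟩
  rcases 𝒰.union_mem_iff.1 h with h | h
  · obtain ⟨y, hy, e⟩ := hA.2 𝒰 h x hx ht
    exact ⟨y, Or.inl hy, e⟩
  · obtain ⟨y, hy, e⟩ := hB.2 𝒰 h x hx ht
    exact ⟨y, Or.inr hy, e⟩

/-- Sheaves of abelian groups on a topological space. -/
abbrev Sh (X : TopCat.{u}) := TopCat.Sheaf AddCommGrpCat.{u} X

namespace Sh

variable {X Y Z W : TopCat.{u}}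

/-- The support of a section `s` of a sheaf over an open set `V`: the points of `V` at which the
germ of `s` is non-zero. -/
def supp (F : Sh Y) {V : Opens Y} (s : F.presheaf.obj (op V)) : Set Y :=
  {y | ∃ h : y ∈ V, F.presheaf.germ V y h s ≠ 0}

lemma supp_subset (F : Sh Y) {V : Opens Y} (s : F.presheaf.obj (op V)) : F.supp s ⊆ V :=
  fun _ h => h.1

lemma supp_map (F : Sh Y) {V V' : Opens Y} (i : V' ⟶ V) (s : F.presheaf.obj (op V)) :
    F.supp (F.presheaf.map i.op s) = F.supp s ∩ V' := by
  ext y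
  constructor
  · rintro ⟨h, hs⟩
    rw [TopCat.Presheaf.germ_res_apply] at hs
    exact ⟨⟨_, hs⟩, h⟩
  · rintro ⟨⟨_, hs⟩, h⟩
    refine ⟨h, ?_⟩
    rwa [TopCat.Presheaf.germ_res_apply]

lemma exists_of_notMem_supp (F : Sh Y) {V : Opens Y} (s : F.presheaf.obj (op V)) {y : Y}
    (hy : y ∈ V) (h : y ∉ F.supp s) :
    ∃ (V' : Opens Y) (_ : y ∈ V') (i : V' ⟶ V), F.presheaf.map i.op s = 0 := by
  have : F.presheaf.germ V y hy s = F.presheaf.germ V y hy 0 := by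
    by_contra h'
    exact h ⟨hy, by simpa using h'⟩
  obtain ⟨V', hV', i, j, e⟩ := F.presheaf.germ_eq y hy hy _ _ this
  exact ⟨V', hV', i, by simpa using e⟩

lemma supp_zero (F : Sh Y) {V : Opens Y} : F.supp (0 : F.presheaf.obj (op V)) = ∅ := by
  ext y
  simp [supp]

lemma compl_supp_mem_nhds (F : Sh Y) {V : Opens Y} (s : F.presheaf.obj (op V)) {y : Y}
    (hy : y ∈ V) (h : y ∉ F.supp s) : (F.supp s)ᶜ ∈ 𝓝 y := by
  obtain ⟨V', hV', i, e⟩ := F.exists_of_notMem_supp s hy h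
  refine mem_of_superset (V'.isOpen.mem_nhds hV') fun z hz hzs => ?_
  have := (F.supp_map i s).symm.subset ⟨hzs, hz⟩
  rw [e, supp_zero] at this
  exact this

lemma supp_add_subset (F : Sh Y) {V : Opens Y} (s t : F.presheaf.obj (op V)) :
    F.supp (s + t) ⊆ F.supp s ∪ F.supp t := by
  rintro y ⟨h, hy⟩
  by_contra hn
  simp only [supp, Set.mem_union, Set.mem_ofPred_eq, not_or, not_exists, not_not] at hn
  exact hy (by rw [map_add, hn.1 h, hn.2 h, add_zero])

lemma supp_neg (F : Sh Y) {V : Opens Y} (s : F.presheaf.obj (op V)) :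
    F.supp (-s) = F.supp s := by
  simp [supp]

lemma supp_hom_subset {F G : Sh Y} (φ : F ⟶ G) {V : Opens Y} (s : F.presheaf.obj (op V)) :
    G.supp (φ.hom.app (op V) s) ⊆ F.supp s := by
  rintro y ⟨h, hy⟩
  refine ⟨h, fun h0 => hy ?_⟩
  rw [← TopCat.Presheaf.stalkFunctor_map_germ_apply]
  exact (congrArg _ h0).trans (map_zero _)

/-- The sections `s` of `F` over `f⁻¹(U)` such that `f : supp s → U` is proper. -/
def properSections (f : Y ⟶ X) (F : Sh Y) (U : Opens X) :
    AddSubgroup (F.presheaf.obj (op ((Opens.map f).obj U))) where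
  carrier := {s | ProperOver f (F.supp s) (U : Set X)}
  zero_mem' := by
    change ProperOver f (F.supp 0) (U : Set X)
    rw [supp_zero, properOver_iff f.hom.continuous]
    exact ⟨Set.mapsTo_empty _ _, fun 𝒰 h => (𝒰.empty_notMem h).elim⟩
  add_mem' {s t} hs ht := by
    refine (hs.union f.hom.continuous ht).mono f.hom.continuous (F.supp_add_subset s t) subset_rfl
      (F.supp_subset _) fun _ _ hy hy' => F.compl_supp_mem_nhds _ hy hy'
  neg_mem' {s} hs := by
    change ProperOver f (F.supp (-s)) (U : Set X)
    rw [supp_neg]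
    exact hs

lemma map_mem_properSections (f : Y ⟶ X) (F : Sh Y) {U V : Opens X} (i : V ⟶ U)
    {s : F.presheaf.obj (op ((Opens.map f).obj U))} (hs : s ∈ properSections f F U) :
    F.presheaf.map ((Opens.map f).map i).op s ∈ properSections f F V := by
  refine ProperOver.mono f.hom.continuous hs ?_ i.le (F.supp_subset _)
    fun _ _ hy hy' => F.compl_supp_mem_nhds _ hy hy'
  rw [supp_map]
  exact Set.inter_subset_left

lemma hom_mem_properSections (f : Y ⟶ X) {F G : Sh Y} (φ : F ⟶ G) {U : Opens X}
    {s : F.presheaf.obj (op ((Opens.map f).obj U))} (hs : s ∈ properSections f F U) :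
    φ.hom.app _ s ∈ properSections f G U :=
  ProperOver.mono f.hom.continuous hs (supp_hom_subset φ s) subset_rfl (G.supp_subset _)
    fun _ _ hy hy' => G.compl_supp_mem_nhds _ hy hy'

/-- The presheaf underlying the proper direct image of `F`. -/
def properDirectImagePresheaf (f : Y ⟶ X) (F : Sh Y) : TopCat.Presheaf AddCommGrpCat.{u} X where
  obj U := AddCommGrpCat.of (properSections f F U.unop)
  map {U V} i := AddCommGrpCat.ofHom
    (((F.presheaf.map ((Opens.map f).map i.unop).op).hom.comp
      (properSections f F U.unop).subtype).codRestrict (properSections f F V.unop)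
        fun s => map_mem_properSections f F i.unop s.2)
  map_id U := by
    ext s
    exact ConcreteCategory.congr_hom (F.presheaf.map_id _) s.1
  map_comp {U V T} i j := by
    ext s
    exact ConcreteCategory.congr_hom (F.presheaf.map_comp
      ((Opens.map f).map i.unop).op ((Opens.map f).map j.unop).op) s.1

lemma properDirectImagePresheaf_isSheaf (f : Y ⟶ X) (F : Sh Y) :
    (properDirectImagePresheaf f F).IsSheaf := by
  rw [TopCat.Presheaf.isSheaf_iff_isSheafUniqueGluing]
  intro ι U sf hsf
  obtain ⟨s, hs, huniq⟩ := (TopCat.Presheaf.isSheaf_iff_isSheafUniqueGluing _).1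
    ((TopCat.Sheaf.pushforward AddCommGrpCat.{u} f).obj F).2 U (fun i => (sf i).1)
    (fun i j => congrArg Subtype.val (hsf i j))
  have hsupp : ∀ i, F.supp (V := (Opens.map f).obj (iSup U)) s ∩ (Opens.map f).obj (U i) =
      F.supp (V := (Opens.map f).obj (U i)) (sf i).1 := fun i => by
    refine (F.supp_map ((Opens.map f).map (Opens.leSupr U i)) s).symm.trans ?_
    exact congrArg (F.supp (V := (Opens.map f).obj (U i))) (hs i)
  have hmem : s ∈ properSections f F (iSup U) := by
    refine (properOver_iff f.hom.continuous).2 ⟨F.supp_subset _, fun 𝒰 hA x hx ht => ?_⟩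
    obtain ⟨i, hi⟩ := Opens.mem_iSup.1 hx
    have h1 : f ⁻¹' (U i) ∈ 𝒰 := ht ((U i).isOpen.mem_nhds hi)
    obtain ⟨y, hy, e⟩ := ((properOver_iff f.hom.continuous).1 (sf i).2).2 𝒰
      (mem_of_superset (inter_mem hA h1) (hsupp i).subset) x hi ht
    exact ⟨y, ((hsupp i).symm.subset hy).1, e⟩
  refine ⟨⟨s, hmem⟩, fun i => Subtype.ext (hs i), fun t ht => Subtype.ext ?_⟩
  exact huniq t.1 fun i => congrArg Subtype.val (ht i)

/-- The proper direct image functor `f_(!)`. -/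
noncomputable def properDirectImage (f : Y ⟶ X) : Sh Y ⥤ Sh X where
  obj F := ⟨properDirectImagePresheaf f F, properDirectImagePresheaf_isSheaf f F⟩
  map {F G} φ := ⟨{
    app U := AddCommGrpCat.ofHom (((φ.hom.app _).hom.comp
      (properSections f F U.unop).subtype).codRestrict (properSections f G U.unop)
        fun s => hom_mem_properSections f φ s.2)
    naturality U V i := by
      ext s
      apply Subtype.ext
      exact ConcreteCategory.congr_hom (φ.hom.naturality ((Opens.map f).map i.unop).op) s.1 }⟩
  map_id F := rfl
  map_comp φ ψ := rfl

instance (f : Y ⟶ X) : (properDirectImage f).Additive where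
  map_add := rfl

/-- The inverse image functor `f^(*)`. -/
noncomputable abbrev inverseImage (f : Y ⟶ X) : Sh X ⥤ Sh Y :=
  TopCat.Sheaf.pullback AddCommGrpCat.{u} f

/-- The direct image functor `f_(*)`. -/
noncomputable abbrev directImage (f : Y ⟶ X) : Sh Y ⥤ Sh X :=
  TopCat.Sheaf.pushforward AddCommGrpCat.{u} f

instance (f : Y ⟶ X) : (directImage f).Additive where
  map_add := rfl

instance (f : Y ⟶ X) : (inverseImage f).Additive :=
  (TopCat.Sheaf.pullbackPushforwardAdjunction AddCommGrpCat.{u} f).left_adjoint_additive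

lemma nhds_eq_of_homeomorph {S A B : Type*} [TopologicalSpace S] [TopologicalSpace A]
    [TopologicalSpace B] {P : A × B → Prop} (e : S ≃ₜ {a : A × B // P a}) (x : S) :
    𝓝 x = comap (fun x => (e x).1.1) (𝓝 (e x).1.1) ⊓ comap (fun x => (e x).1.2) (𝓝 (e x).1.2) := by
  refine ((IsInducing.subtypeVal.comp e.isInducing).nhds_eq_comap x).trans ?_
  rw [nhds_prod_eq, Filter.prod_eq_inf, Filter.comap_inf, Filter.comap_comap, Filter.comap_comap]
  rfl

lemma properOver_baseChange {f : Y ⟶ X} {q : W ⟶ Y} {p : Z ⟶ X} {g : W ⟶ Z}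
    (sq : IsPullback q g f p) {A : Set Y} {B : Set W} {U : Set X}
    (hA : ProperOver f A U) (hBA : Set.MapsTo q B A)
    (hcl : ∀ x : W, p (g x) ∈ U → x ∉ B → Bᶜ ∈ 𝓝 x) :
    ProperOver g B (p ⁻¹' U) := by
  have hw : ∀ x : W, f (q x) = p (g x) := fun x => ConcreteCategory.congr_hom sq.w x
  rw [properOver_iff f.hom.continuous] at hA
  refine (properOver_iff g.hom.continuous).2 ⟨fun x hx => ?_, fun 𝒰 hB z hz ht => ?_⟩
  · change p (g x) ∈ U
    rw [← hw]
    exact hA.1 (hBA hx)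
  · obtain ⟨y, hy, hyz, hle⟩ := hA.2 (𝒰.map q) (mem_of_superset (x := B) hB hBA) (p z) hz (by
      rw [Ultrafilter.coe_map, tendsto_map'_iff]
      have : (f ∘ q : W → X) = p ∘ g := funext hw
      rw [this]
      exact (p.hom.continuous.tendsto z).comp ht)
    obtain ⟨x, hx1, hx2, hind⟩ : ∃ x : W, q x = y ∧ g x = z ∧
        𝓝 x = comap q (𝓝 (q x)) ⊓ comap g (𝓝 (g x)) := by
      let e : W ≅ (TopCat.pullbackCone f p).pt :=
        sq.isLimit.conePointUniqueUpToIso (TopCat.pullbackConeIsLimit f p)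
      have h1 : e.hom ≫ TopCat.pullbackFst f p = q :=
        sq.isLimit.conePointUniqueUpToIso_hom_comp (TopCat.pullbackConeIsLimit f p) .left
      have h2 : e.hom ≫ TopCat.pullbackSnd f p = g :=
        sq.isLimit.conePointUniqueUpToIso_hom_comp (TopCat.pullbackConeIsLimit f p) .right
      let t : {a : Y × Z // f a.1 = p a.2} := ⟨(y, z), hyz⟩
      have ht : e.hom (e.inv t) = t := ConcreteCategory.congr_hom e.inv_hom_id t
      refine ⟨e.inv t, ?_, ?_, ?_⟩
      · rw [← h1]
        exact congrArg (fun a => a.1.1) ht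
      · rw [← h2]
        exact congrArg (fun a => a.1.2) ht
      · refine (nhds_eq_of_homeomorph (TopCat.homeoOfIso e :
          W ≃ₜ {a : Y × Z // f a.1 = p a.2}) (e.inv t)).trans ?_
        rw [← h1, ← h2]
        rfl
    have hle' : (𝒰 : Filter W) ≤ 𝓝 x := by
      rw [hind, hx1, hx2]
      exact le_inf (map_le_iff_le_comap.1 hle) (map_le_iff_le_comap.1 ht)
    refine ⟨x, ?_, hx2, hle'⟩
    by_contra hxB
    exact 𝒰.compl_mem_iff_notMem.1 (hle' (hcl x (by rw [hx2]; exact hz) hxB)) hB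

/-- For a cartesian square `f ∘ q = p ∘ g`, the equality of open sets `q⁻¹(f⁻¹(U)) = g⁻¹(p⁻¹(U))`,
as a morphism. -/
def opensHom {f : Y ⟶ X} {q : W ⟶ Y} {p : Z ⟶ X} {g : W ⟶ Z} (w : q ≫ f = g ≫ p) (U : Opens X) :
    (Opens.map g).obj ((Opens.map p).obj U) ⟶ (Opens.map q).obj ((Opens.map f).obj U) :=
  homOfLE fun x hx => by
    change (q ≫ f) x ∈ U
    rw [w]
    exact hx

lemma baseChange_mem {f : Y ⟶ X} {q : W ⟶ Y} {p : Z ⟶ X} {g : W ⟶ Z}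
    (sq : IsPullback q g f p) (G : Sh W) (U : Opens X)
    {s : G.presheaf.obj (op ((Opens.map q).obj ((Opens.map f).obj U)))}
    (hs : s ∈ properSections f ((directImage q).obj G) U) :
    G.presheaf.map (opensHom sq.w U).op s ∈ properSections g G ((Opens.map p).obj U) := by
  refine properOver_baseChange sq hs ?_ fun x hx hx' => G.compl_supp_mem_nhds _ hx hx'
  rw [supp_map]
  rintro x ⟨hx, -⟩
  by_contra hn
  obtain ⟨V, hV, i, e⟩ := exists_of_notMem_supp ((directImage q).obj G)
    (V := (Opens.map f).obj U) s hx.1 hn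
  have h1 := (G.supp_map ((Opens.map q).map i) s).symm.subset ⟨hx, hV⟩
  have h2 : G.presheaf.map ((Opens.map q).map i).op s = 0 := e
  rw [h2, supp_zero] at h1
  exact h1

/-- For a cartesian square, the morphism `f_(!) ∘ q_(*) ⟶ p_(*) ∘ g_(!)` which is the restriction of
the identity `f_(*) ∘ q_(*) = p_(*) ∘ g_(*)`. -/
noncomputable def directBaseChange {f : Y ⟶ X} {q : W ⟶ Y} {p : Z ⟶ X} {g : W ⟶ Z}
    (sq : IsPullback q g f p) :
    directImage q ⋙ properDirectImage f ⟶ properDirectImage g ⋙ directImage p where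
  app G := ⟨{
    app U := AddCommGrpCat.ofHom (((G.presheaf.map (opensHom sq.w U.unop).op).hom.comp
      (properSections f ((directImage q).obj G) U.unop).subtype).codRestrict
        (properSections g G ((Opens.map p).obj U.unop)) fun s => baseChange_mem sq G U.unop s.2)
    naturality U V i := by
      ext s
      apply Subtype.ext
      exact (ConcreteCategory.congr_hom (G.presheaf.map_comp
        ((Opens.map q).map ((Opens.map f).map i.unop)).op (opensHom sq.w V.unop).op) s.1).symm.trans
        (ConcreteCategory.congr_hom (G.presheaf.map_comp (opensHom sq.w U.unop).op
        ((Opens.map g).map ((Opens.map p).map i.unop)).op) s.1) }⟩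
  naturality G G' φ := by
    apply ObjectProperty.hom_ext
    ext U s
    exact Subtype.ext
      (ConcreteCategory.congr_hom (φ.hom.naturality (opensHom sq.w U.unop).op).symm s.1)

/-- For a cartesian square, the proper base change morphism `p^(*) ∘ f_(!) ⟶ g_(!) ∘ q^(*)`:
it is adjoint to the composition `f_(!) ⟶ f_(!) ∘ q_(*) ∘ q^(*) ⟶ p_(*) ∘ g_(!) ∘ q^(*)`. -/
noncomputable def baseChange {f : Y ⟶ X} {q : W ⟶ Y} {p : Z ⟶ X} {g : W ⟶ Z}
    (sq : IsPullback q g f p) :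
    properDirectImage f ⋙ inverseImage p ⟶ inverseImage q ⋙ properDirectImage g where
  app F :=
    ((TopCat.Sheaf.pullbackPushforwardAdjunction AddCommGrpCat.{u} p).homEquiv _ _).symm
      ((properDirectImage f).map
          ((TopCat.Sheaf.pullbackPushforwardAdjunction AddCommGrpCat.{u} q).unit.app F) ≫
        (directBaseChange sq).app ((inverseImage q).obj F))
  naturality F F' φ := by
    have h1 := (TopCat.Sheaf.pullbackPushforwardAdjunction AddCommGrpCat.{u} q).unit.naturality φ
    have h2 := (directBaseChange sq).naturality ((inverseImage q).map φ)
    dsimp only [Functor.comp_obj, Functor.comp_map, Functor.id_obj, Functor.id_map] at h1 h2 ⊢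
    rw [← Adjunction.homEquiv_naturality_left_symm, ← Adjunction.homEquiv_naturality_right_symm,
      ← Functor.map_comp_assoc, h1, Functor.map_comp_assoc, h2, Category.assoc]

end Sh

noncomputable section

namespace CategoryTheory.Functor

variable {C D E : Type*} [Category* C] [Category* D] [Category* E]
  [Abelian C] [Abelian D] [Abelian E]

lemma natTrans_commShift_of_whiskerLeft {A B H : Type*} [Category* A] [Category* B] [Category* H]
    [HasShift A ℤ] [HasShift B ℤ] [HasShift H ℤ] (i : A ⥤ B) {G₁ G₂ : B ⥤ H} [i.CommShift ℤ]
    [G₁.CommShift ℤ] [G₂.CommShift ℤ] (τ : G₁ ⟶ G₂) [NatTrans.CommShift (whiskerLeft i τ) ℤ]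
    (h : ∀ K : B, ∃ (I : A) (w : K ⟶ i.obj I), IsIso (G₂.map w)) : NatTrans.CommShift τ ℤ where
  shift_comm a := by
    apply NatTrans.ext
    funext K
    obtain ⟨I, w, hw⟩ := h K
    have key := NatTrans.shift_app_comm (whiskerLeft i τ) a I
    simp only [commShiftIso_comp_hom_app, whiskerLeft_app, Category.assoc, comp_obj] at key
    rw [← NatTrans.naturality_assoc] at key
    have H := (cancel_epi _).1 key
    have h3 := (G₁.commShiftIso a).hom.naturality w
    have h4 := (G₂.commShiftIso a).hom.naturality w
    simp only [comp_map, comp_obj] at h3 h4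
    simp only [NatTrans.comp_app, whiskerRight_app, whiskerLeft_app]
    rw [← cancel_mono ((shiftFunctor _ a).map (G₂.map w)), Category.assoc, ← Functor.map_comp,
      ← τ.naturality, Functor.map_comp, ← reassoc_of% h3, H, Category.assoc, ← h4,
      NatTrans.naturality_assoc]

section
variable (C) [HasDerivedCategory C]

/-- The functor `K⁺(Inj C) ⥤ D⁺(C)`. -/
abbrev injectivesToDerivedPlus : HomotopyCategory.Plus (InjectiveObject C) ⥤ DerivedCategory.Plus C :=
  (InjectiveObject.ι C).mapHomotopyCategoryPlus ⋙ DerivedCategory.Plus.Qh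

lemma injectivesToDerivedPlus_map_bijective (K L : HomotopyCategory.Plus (InjectiveObject C)) :
    Function.Bijective ((injectivesToDerivedPlus C).map : (K ⟶ L) → _) := by
  have h : CochainComplex.IsKInjective
      (((InjectiveObject.ι C).mapHomotopyCategoryPlus.obj L).1.as) := by
    have (M : CochainComplex.Plus (InjectiveObject C)) : CochainComplex.IsKInjective
      (((InjectiveObject.ι C).mapHomologicalComplex (.up ℤ)).obj M.obj) := inferInstance
    exact this ⟨L.obj.as, (HomotopyCategory.plus_quotient_obj_iff _).1 L.property⟩
  exact (DerivedCategory.Plus.Qh_map_bijective_of_isKInjective _ _ h).comp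
    ((FullyFaithful.ofFullyFaithful (InjectiveObject.ι C).mapHomotopyCategoryPlus).map_bijective
      K L)

instance : (injectivesToDerivedPlus C).Full where
  map_surjective := (injectivesToDerivedPlus_map_bijective C _ _).2

instance : (injectivesToDerivedPlus C).Faithful where
  map_injective {K L} := fun {_ _} h => (injectivesToDerivedPlus_map_bijective C K L).1 h

instance [EnoughInjectives C] : (injectivesToDerivedPlus C).IsEquivalence where

instance [EnoughInjectives C] : (injectivesToDerivedPlus C).IsLocalization
    (MorphismProperty.isomorphisms _) :=
  IsLocalization.of_isEquivalence _ _ (fun _ _ _ h => h)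
end

variable [HasDerivedCategory C] [HasDerivedCategory D] [HasDerivedCategory E]

section
variable [EnoughInjectives C] (F : C ⥤ D) [F.Additive]

instance : IsIso (whiskerLeft (InjectiveObject.ι C).mapHomotopyCategoryPlus
    F.rightDerivedFunctorPlusUnit) := by
  rw [NatTrans.isIso_iff_isIso_app]
  intro K
  exact inferInstanceAs (IsIso (F.rightDerivedFunctorPlusUnit.app
    ((InjectiveObject.ι C).mapHomotopyCategoryPlus.obj K)))

/-- On complexes of injective objects, the right derived functor is computed by `F`. -/
def rightDerivedFunctorPlusInjectivesIso :
    injectivesToDerivedPlus C ⋙ F.rightDerivedFunctorPlus ≅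
      (InjectiveObject.ι C).mapHomotopyCategoryPlus ⋙ F.mapHomotopyCategoryPlus ⋙
        DerivedCategory.Plus.Qh :=
  (asIso (whiskerLeft (InjectiveObject.ι C).mapHomotopyCategoryPlus
    F.rightDerivedFunctorPlusUnit)).symm

instance rightDerivedFunctorPlusLifting :
    Localization.Lifting (injectivesToDerivedPlus C) (MorphismProperty.isomorphisms _)
      ((InjectiveObject.ι C).mapHomotopyCategoryPlus ⋙ F.mapHomotopyCategoryPlus ⋙
        DerivedCategory.Plus.Qh) F.rightDerivedFunctorPlus :=
  ⟨rightDerivedFunctorPlusInjectivesIso F⟩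

/-- The compatibility of the right derived functor with the shift: it is the one for which
the unit `F ⟶ RF` commutes with the shift. -/
instance rightDerivedFunctorPlusCommShift : F.rightDerivedFunctorPlus.CommShift ℤ :=
  commShiftOfLocalization (injectivesToDerivedPlus C) (MorphismProperty.isomorphisms _) ℤ
    ((InjectiveObject.ι C).mapHomotopyCategoryPlus ⋙ F.mapHomotopyCategoryPlus ⋙
        DerivedCategory.Plus.Qh) F.rightDerivedFunctorPlus

instance : NatTrans.CommShift (rightDerivedFunctorPlusInjectivesIso F).hom ℤ :=
  NatTrans.commShift_iso_hom_of_localization (injectivesToDerivedPlus C)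
    (MorphismProperty.isomorphisms _) ℤ
    ((InjectiveObject.ι C).mapHomotopyCategoryPlus ⋙ F.mapHomotopyCategoryPlus ⋙
        DerivedCategory.Plus.Qh) F.rightDerivedFunctorPlus

instance : F.rightDerivedFunctorPlus.IsTriangulated :=
  isTriangulated_of_precomp_iso (rightDerivedFunctorPlusInjectivesIso F)

/-- The unit of the right derived functor commutes with the shift. -/
instance rightDerivedFunctorPlusUnit_commShift :
    NatTrans.CommShift F.rightDerivedFunctorPlusUnit ℤ := by
  have e : ((rightDerivedFunctorPlusInjectivesIso F).inv ≫ (associator _ _ _).hom) =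
    whiskerLeft (InjectiveObject.ι C).mapHomotopyCategoryPlus F.rightDerivedFunctorPlusUnit := by
    ext K
    simp [rightDerivedFunctorPlusInjectivesIso]
  have key : NatTrans.CommShift (whiskerLeft (InjectiveObject.ι C).mapHomotopyCategoryPlus
      F.rightDerivedFunctorPlusUnit) ℤ := by
    rw [← e]
    infer_instance
  refine natTrans_commShift_of_whiskerLeft (InjectiveObject.ι C).mapHomotopyCategoryPlus _
    fun K => ?_
  let r : (HomotopyCategory.Plus.localizerMorphism C).RightResolution K := Classical.arbitrary _
  have hw : IsIso (DerivedCategory.Plus.Qh.map r.w) :=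
    Localization.inverts DerivedCategory.Plus.Qh (HomotopyCategory.Plus.quasiIso C) _ r.hw
  exact ⟨r.X₁, r.w, inferInstanceAs (IsIso (F.rightDerivedFunctorPlus.map
    (DerivedCategory.Plus.Qh.map r.w)))⟩

end

/-- The natural transformation on bounded below homotopy categories induced by a natural
transformation of additive functors. -/
def natTransMapHomotopyCategoryPlus {F G : C ⥤ D} [F.Additive] [G.Additive] (τ : F ⟶ G) :
    F.mapHomotopyCategoryPlus ⟶ G.mapHomotopyCategoryPlus where
  app K := ObjectProperty.homMk
    ((NatTrans.mapHomotopyCategory τ (.up ℤ)).app K.obj)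
  naturality K L f := by
    ext
    exact (NatTrans.mapHomotopyCategory τ (.up ℤ)).naturality f.hom

/-- The morphism `RF ⟶ RG` of right derived functors induced by `τ : F ⟶ G`. -/
def rightDerivedPlusNatTrans [EnoughInjectives C] {F G : C ⥤ D} [F.Additive] [G.Additive]
    (τ : F ⟶ G) : F.rightDerivedFunctorPlus ⟶ G.rightDerivedFunctorPlus :=
  rightDerivedNatTrans _ _ F.rightDerivedFunctorPlusUnit G.rightDerivedFunctorPlusUnit
    (HomotopyCategory.Plus.quasiIso C)
    (whiskerRight (natTransMapHomotopyCategoryPlus τ) DerivedCategory.Plus.Qh)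

/-- The canonical morphism `R(G ∘ F) ⟶ RG ∘ RF`, obtained from the universal property of
`R(G ∘ F)` and the morphism `G ∘ F ⟶ RG ∘ F ⟶ RG ∘ RF` given by the units of `RG` and `RF`. -/
def rightDerivedPlusComp [EnoughInjectives C] [EnoughInjectives D] (F : C ⥤ D) (G : D ⥤ E)
    [F.Additive] [G.Additive] :
    (F ⋙ G).rightDerivedFunctorPlus ⟶ F.rightDerivedFunctorPlus ⋙ G.rightDerivedFunctorPlus :=
  rightDerivedDesc _ (F ⋙ G).rightDerivedFunctorPlusUnit (HomotopyCategory.Plus.quasiIso C) _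
    (whiskerRight (mapHomotopyCategoryPlusCompIso (Iso.refl (F ⋙ G))).inv DerivedCategory.Plus.Qh ≫
      whiskerLeft F.mapHomotopyCategoryPlus G.rightDerivedFunctorPlusUnit ≫
      whiskerRight F.rightDerivedFunctorPlusUnit G.rightDerivedFunctorPlus)

end CategoryTheory.Functor

/-- An isomorphism of triangulated functors: both functors are triangulated, and the natural
transformation is an isomorphism which commutes with the shift. -/
structure IsTriangulatedIso {C D : Type*} [Category* C] [Category* D]
    [HasZeroObject C] [HasShift C ℤ] [Preadditive C] [∀ n : ℤ, (shiftFunctor C n).Additive]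
    [Pretriangulated C]
    [HasZeroObject D] [HasShift D ℤ] [Preadditive D] [∀ n : ℤ, (shiftFunctor D n).Additive]
    [Pretriangulated D]
    {F G : C ⥤ D} [F.CommShift ℤ] [G.CommShift ℤ] (τ : F ⟶ G) : Prop where
  source_isTriangulated : F.IsTriangulated
  target_isTriangulated : G.IsTriangulated
  commShift : NatTrans.CommShift τ ℤ
  isIso : IsIso τ

namespace Sh

variable {X Y : TopCat.{u}} [HasDerivedCategory.{w₁} (Sh X)] [HasDerivedCategory.{w₂} (Sh Y)]

/-- The derived proper direct image `f_! : D⁺(Y) ⥤ D⁺(X)`. -/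
abbrev derivedProperDirectImage (f : Y ⟶ X) :
    DerivedCategory.Plus (Sh Y) ⥤ DerivedCategory.Plus (Sh X) :=
  (properDirectImage f).rightDerivedFunctorPlus

/-- The derived functor `f^* : D⁺(X) ⥤ D⁺(Y)` of the (exact) inverse image functor `f^(*)`. -/
abbrev derivedInverseImage (f : Y ⟶ X) :
    DerivedCategory.Plus (Sh X) ⥤ DerivedCategory.Plus (Sh Y) :=
  (inverseImage f).rightDerivedFunctorPlus

end Sh

end

/-! The underived statement rests on a description of stalks: for `f` separated and locally proper,
the stalk of `f_(!) F` at `x` is the group of compactly supported sections of `F` along the fibre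
over `x`. A germ that vanishes on the fibre is zero, because a support that is proper over a
neighbourhood of `x` and misses the fibre over `x` misses the nearby fibres too
(`properSections_eq_zero_of_fiber`). Conversely, a compactly supported section on the fibre extends
to an open neighbourhood of a compact part of the fibre and, after shrinking the base, can be
extended by zero (`exists_properSections_of_fiber`). The fibre of `g` over `z` is identified by `q`
with the fibre of `f` over `p z`, and `q^(*) F` has the same stalks, hence the same sections along
the fibre, as `F`. So `β` is bijective on stalks (`isIso_baseChange`).

For the derived statement it suffices to treat complexes of injectives. There the comparison map
from `R(G ∘ F)` to `RG ∘ RF` is, up to isomorphisms, the unit of `RG` at the image under `F` of the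
complex (`isIso_rightDerivedPlusComp`). If `G` is an inverse image it is exact, and the unit is
always invertible. If `G` is `g_(!)`, the terms are of the form `q^(*) I` with `I` injective. They
need not be injective, but they are soft on the fibres of `g`: such a fibre sits in `Y` as a fibre
of `f`, a section of `I` on a compact part of it extends to an open set, and then to all of `Y`
because `I` is flasque. Sheaves that are soft on the fibres are closed under cokernels of
monomorphisms, and `g_(!)` is exact on short exact sequences with such a kernel, by lifting
compactly supported sections on locally compact Hausdorff fibres. Hence they compute the derived
functor of `g_(!)`.

Sections along a map into the base space are treated throughout as families of germs that are
continuous into the étale space, so that gluing over open or closed covers is gluing of continuous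
maps. -/

section FiberTopology

/-! ### Topology of separated and locally proper maps near a fibre. -/

variable {Y X : Type*} [TopologicalSpace Y] {f : Y → X}

/-- The neighbourhoods are taken in the total space, not only in the fibre; this is what separates
compact parts of a fibre by open subsets of `Y`. -/
lemma IsSeparatedMap.disjoint_nhds (hf : IsSeparatedMap f) {y y' : Y} (h : f y = f y')
    (hne : y ≠ y') : Disjoint (𝓝 y) (𝓝 y') := by
  obtain ⟨s, t, hs, ht, hys, hyt, hd⟩ := hf y y' h hne
  exact Filter.disjoint_iff.2 ⟨s, hs.mem_nhds hys, t, ht.mem_nhds hyt, hd⟩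

lemma IsSeparatedMap.t2Space_fiber (hf : IsSeparatedMap f) (x : X) : T2Space (f ⁻¹' {x}) :=
  t2Space_iff_disjoint_nhds.2 fun a b hab => by
    have h : f a = f b := a.2.trans b.2.symm
    have := hf.disjoint_nhds h (fun e => hab (Subtype.ext e))
    change Disjoint (𝓝 a) (𝓝 b)
    rw [nhds_subtype, nhds_subtype]
    exact Filter.disjoint_comap this

variable [TopologicalSpace X]

/-- An ultrafilter containing the fibre has principal image at `x`, hence image converging to `x`,
and properness supplies a limit in `A` over `x`. -/
lemma ProperOver.isCompact_inter_fiber (hc : Continuous f) {A : Set Y} {U : Set X}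
    (h : ProperOver f A U) {x : X} (hx : x ∈ U) : IsCompact (A ∩ f ⁻¹' {x}) := by
  rw [isCompact_iff_ultrafilter_le_nhds']
  intro 𝒰 h𝒰
  have hA : A ∈ 𝒰 := mem_of_superset h𝒰 Set.inter_subset_left
  have hfx : f ⁻¹' {x} ∈ 𝒰 := mem_of_superset h𝒰 Set.inter_subset_right
  obtain ⟨y, hy, hyx, hle⟩ := ((properOver_iff hc).1 h).2 𝒰 hA x hx
    ((le_pure_iff.2 (show {x} ∈ Filter.map f 𝒰 from hfx)).trans (pure_le_nhds x))
  exact ⟨y, ⟨hy, hyx⟩, hle⟩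

/-- A subset which is proper over `U` and does not meet the fiber over `x` does not meet
the neighbouring fibers either. -/
lemma ProperOver.eventually_notMem (hc : Continuous f) {A : Set Y} {U : Set X}
    (h : ProperOver f A U) {x : X} (hx : x ∈ U) (hA : ∀ y ∈ A, f y ≠ x) :
    ∃ V : Set X, IsOpen V ∧ x ∈ V ∧ ∀ y ∈ A, f y ∉ V := by
  by_contra! hn
  -- If `A` met the preimage of every neighbourhood of `x`, an ultrafilter finer than this filter
  -- would have, by properness, a limit in `A` over `x`.
  have hne : (𝓟 A ⊓ comap f (𝓝 x)).NeBot := by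
    rw [inf_comm, ((nhds_basis_opens x).comap f).inf_principal_neBot_iff]
    rintro V ⟨hxV, hV⟩
    obtain ⟨y, hy, hyV⟩ := hn V hV hxV
    exact ⟨y, hyV, hy⟩
  obtain ⟨y, hy, hyx, -⟩ := ((properOver_iff hc).1 h).2
    (Ultrafilter.of (𝓟 A ⊓ comap f (𝓝 x)))
    ((Ultrafilter.of_le _).trans inf_le_left (mem_principal_self A)) x hx
    (tendsto_iff_comap.2 ((Ultrafilter.of_le _).trans inf_le_right))
  exact hA y hy hyx

/-- Otherwise some ultrafilter on `A` converges to `y`. Properness gives it a second limit, in `A`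
and in the same fibre, against separatedness. Thus `A` is closed in the preimage of `U`. -/
lemma ProperOver.compl_mem_nhds (hc : Continuous f) (hf : IsSeparatedMap f) {A : Set Y}
    {U : Set X} (h : ProperOver f A U) {y : Y} (hyU : f y ∈ U) (hy : y ∉ A) : Aᶜ ∈ 𝓝 y := by
  by_contra hn
  have hne : (𝓝 y ⊓ 𝓟 A).NeBot := by
    rwa [← mem_interior_iff_mem_nhds, interior_compl, Set.notMem_compl_iff,
      mem_closure_iff_nhdsWithin_neBot] at hn
  obtain ⟨y', hy', hyy', hle⟩ := ((properOver_iff hc).1 h).2 (Ultrafilter.of (𝓝 y ⊓ 𝓟 A))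
    ((Ultrafilter.of_le _).trans inf_le_right (mem_principal_self A)) (f y) hyU
    ((hc.tendsto y).mono_left ((Ultrafilter.of_le _).trans inf_le_left))
  have hne' : y ≠ y' := fun e => hy (e ▸ hy')
  have := hf.disjoint_nhds hyy'.symm hne'
  exact (Ultrafilter.of (𝓝 y ⊓ 𝓟 A)).neBot.ne
    (le_bot_iff.1 (this ((Ultrafilter.of_le _).trans inf_le_left) hle))

lemma IsLocallyProper.locallyCompactSpace_fiber (hf : IsLocallyProper f) (x : X) :
    LocallyCompactSpace (f ⁻¹' {x}) where
  local_compact_nhds a N hN := by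
    rw [nhds_subtype, mem_comap] at hN
    obtain ⟨V, hV, hVN⟩ := hN
    obtain ⟨A, hA, U, hU, hAV, hp⟩ := hf.2 a V hV
    have hax : f a = x := a.2
    refine ⟨Subtype.val ⁻¹' A, continuous_subtype_val.continuousAt.preimage_mem_nhds hA,
      (Set.preimage_mono hAV).trans hVN, ?_⟩
    rw [Subtype.isCompact_iff, Subtype.image_preimage_coe, Set.inter_comm]
    exact hp.isCompact_inter_fiber hf.1 (hax ▸ mem_of_mem_nhds hU)

lemma ProperOver.inter_preimage (hc : Continuous f) {A : Set Y} {U V : Set X}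
    (h : ProperOver f A U) (hVU : V ⊆ U) : ProperOver f (A ∩ f ⁻¹' V) V := by
  rw [properOver_iff hc] at h ⊢
  refine ⟨fun y hy => hy.2, fun 𝒰 h𝒰 z hz ht => ?_⟩
  obtain ⟨y, hy, rfl, hle⟩ := h.2 𝒰 (mem_of_superset h𝒰 Set.inter_subset_left) z (hVU hz) ht
  exact ⟨y, ⟨hy, hz⟩, rfl, hle⟩

lemma IsLocallyProper.exists_properOver_of_isCompact (hf : IsLocallyProper f) {x : X} {K : Set Y}
    (hK : IsCompact K) (hKx : K ⊆ f ⁻¹' {x}) :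
    ∃ (A : Set Y) (U : Set X), K ⊆ interior A ∧ IsOpen U ∧ x ∈ U ∧ ProperOver f A U := by
  -- Compact induction passes through sets that leave the fibre, so only their intersection with the
  -- fibre is required to lie in `interior A`.
  suffices ∃ (A : Set Y) (U : Set X), K ∩ f ⁻¹' {x} ⊆ interior A ∧ IsOpen U ∧ x ∈ U ∧
      ProperOver f A U by rwa [Set.inter_eq_left.2 hKx] at this
  refine hK.induction_on (p := fun S => ∃ (A : Set Y) (U : Set X), S ∩ f ⁻¹' {x} ⊆ interior A ∧
    IsOpen U ∧ x ∈ U ∧ ProperOver f A U) ?_ ?_ ?_ ?_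
  · refine ⟨∅, Set.univ, by simp, isOpen_univ, Set.mem_univ _, ?_⟩
    exact (properOver_iff hf.1).2 ⟨Set.mapsTo_empty _ _, fun 𝒰 h => (𝒰.empty_notMem h).elim⟩
  · rintro S S' hS ⟨A, U, h, h'⟩
    exact ⟨A, U, (Set.inter_subset_inter_left _ hS).trans h, h'⟩
  · rintro S S' ⟨A, U, hS, hU, hx, hA⟩ ⟨A', U', hS', hU', hx', hA'⟩
    refine ⟨A ∩ f ⁻¹' (U ∩ U') ∪ A' ∩ f ⁻¹' (U ∩ U'), U ∩ U', ?_, hU.inter hU', ⟨hx, hx'⟩,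
      (hA.inter_preimage hf.1 Set.inter_subset_left).union hf.1
        (hA'.inter_preimage hf.1 Set.inter_subset_right)⟩
    rw [← Set.union_inter_distrib_right, interior_inter,
      ((hU.inter hU').preimage hf.1).interior_eq]
    rintro y ⟨hy, rfl : f y = x⟩
    refine ⟨?_, hx, hx'⟩
    rcases hy with hy | hy
    · exact interior_mono Set.subset_union_left (hS ⟨hy, rfl⟩)
    · exact interior_mono Set.subset_union_right (hS' ⟨hy, rfl⟩)
  · intro y hy
    obtain ⟨A, hA, U, hU, -, hp⟩ := hf.2 y Set.univ univ_mem
    obtain rfl : f y = x := hKx hy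
    refine ⟨interior A ∩ f ⁻¹' (interior U), mem_nhdsWithin_of_mem_nhds (inter_mem
      (interior_mem_nhds.2 hA) (hf.1.continuousAt.preimage_mem_nhds (interior_mem_nhds.2 hU))),
      A ∩ f ⁻¹' (interior U), interior U, ?_, isOpen_interior, mem_interior_iff_mem_nhds.2 hU,
      hp.inter_preimage hf.1 interior_subset⟩
    rw [interior_inter, (isOpen_interior.preimage hf.1).interior_eq]
    exact Set.inter_subset_left

end FiberTopology

/-! ### Sections along a map as continuous families of germs. -/

namespace Sh

variable {Y : TopCat.{u}} {T : Type*} [TopologicalSpace T]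

/-- A family of germs `s t ∈ F_{φ t}` is a continuous section of `F` along `φ` on `K` if it is
continuous on `K` as a map to the étale space of `F`. -/
def ContSection (F : Sh Y) (φ : T → Y) (s : ∀ t, F.presheaf.stalk (φ t)) (K : Set T) : Prop :=
  ContinuousOn (fun t => (⟨φ t, s t⟩ : F.presheaf.EtaleSpace)) K

/-- The images of sections generate the topology of the étale space, and two sections with the same
germ agree nearby; so comparison with a single section `σ` is enough. Membership of `φ t'` in `V` is
a premise in `h` because continuity of `φ` already provides it. -/
lemma continuousWithinAt_etaleSpace (F : Sh Y) {φ : T → Y} {s : ∀ t, F.presheaf.stalk (φ t)}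
    {K : Set T} {t : T} (hφ : ContinuousWithinAt φ K t) {V : Opens Y} (hV : φ t ∈ V)
    (σ : F.presheaf.obj (op V)) (hσ : s t = F.presheaf.germ V (φ t) hV σ)
    (h : ∀ᶠ t' in 𝓝[K] t, ∀ h : φ t' ∈ V, s t' = F.presheaf.germ V (φ t') h σ) :
    ContinuousWithinAt (fun t => (⟨φ t, s t⟩ : F.presheaf.EtaleSpace)) K t := by
  refine tendsto_nhds_generateFrom_iff.2 ?_
  rintro _ ⟨U, ρ, rfl⟩ ⟨hU, e⟩
  dsimp at hU e
  obtain ⟨O, hO, i, j, hij⟩ := F.presheaf.germ_eq _ hV hU σ ρ (hσ.symm.trans e)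
  filter_upwards [h, hφ (O.isOpen.mem_nhds hO)] with t' ht' hO'
  refine ⟨j.le hO', ?_⟩
  dsimp
  rw [ht' (i.le hO'), ← F.presheaf.germ_res_apply i _ hO', hij, F.presheaf.germ_res_apply]

lemma ContSection.exists_section {F : Sh Y} {φ : T → Y} {s : ∀ t, F.presheaf.stalk (φ t)}
    {K : Set T} (h : F.ContSection φ s K) {t : T} (ht : t ∈ K) :
    ∃ (V : Opens Y) (hV : φ t ∈ V) (σ : F.presheaf.obj (op V)),
      s t = F.presheaf.germ V (φ t) hV σ ∧
      ∀ᶠ t' in 𝓝[K] t, ∃ h : φ t' ∈ V, s t' = F.presheaf.germ V (φ t') h σ := by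
  obtain ⟨V, hV, σ, hσ⟩ := F.presheaf.exists_germ_eq (s t)
  exact ⟨V, hV, σ, hσ.symm, (h t ht).eventually (TopCat.Presheaf.EtaleSpace.eventually_nhds
    (⟨φ t, s t⟩ : F.presheaf.EtaleSpace) hV σ hσ)⟩

lemma ContSection.continuousOn {F : Sh Y} {φ : T → Y} {s : ∀ t, F.presheaf.stalk (φ t)}
    {K : Set T} (h : F.ContSection φ s K) : ContinuousOn φ K :=
  (TopCat.Presheaf.EtaleSpace.continuous_base F.presheaf).comp_continuousOn h

lemma ContSection.mono {F : Sh Y} {φ : T → Y} {s : ∀ t, F.presheaf.stalk (φ t)}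
    {K L : Set T} (h : F.ContSection φ s K) (hLK : L ⊆ K) : F.ContSection φ s L :=
  ContinuousOn.mono h hLK

lemma ContSection.congr {F : Sh Y} {φ : T → Y} {s s' : ∀ t, F.presheaf.stalk (φ t)}
    {K : Set T} (h : F.ContSection φ s K) (e : ∀ t ∈ K, s' t = s t) : F.ContSection φ s' K :=
  ContinuousOn.congr h fun t ht => by rw [e t ht]

lemma ContSection.union_of_isClosed {F : Sh Y} {φ : T → Y} {s : ∀ t, F.presheaf.stalk (φ t)}
    {K L : Set T} (hK : F.ContSection φ s K) (hL : F.ContSection φ s L) (hK' : IsClosed K)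
    (hL' : IsClosed L) : F.ContSection φ s (K ∪ L) :=
  ContinuousOn.union_of_isClosed hK hL hK' hL'

/-- Both families come from sections of `F` near `φ t`, and equal germs mean equal sections on a
smaller open set. No separation property of the étale space is involved. -/
lemma ContSection.eventually_eq {F : Sh Y} {φ : T → Y} {s s' : ∀ t, F.presheaf.stalk (φ t)}
    {K : Set T} (h : F.ContSection φ s K) (h' : F.ContSection φ s' K) {t : T} (ht : t ∈ K)
    (e : s t = s' t) : ∀ᶠ t' in 𝓝[K] t, s t' = s' t' := by
  obtain ⟨V, hV, σ, hσ, ev⟩ := h.exists_section ht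
  obtain ⟨V', hV', σ', hσ', ev'⟩ := h'.exists_section ht
  obtain ⟨O, hO, i, j, hij⟩ := F.presheaf.germ_eq _ hV hV' σ σ' (by rw [← hσ, ← hσ', e])
  filter_upwards [ev, ev', h.continuousOn t ht (O.isOpen.mem_nhds hO)] with t' h1 h2 hO'
  rw [h1.2, h2.2, ← F.presheaf.germ_res_apply i _ hO', hij, F.presheaf.germ_res_apply]

lemma contSection_zero (F : Sh Y) {φ : T → Y} {K : Set T} (hφ : ContinuousOn φ K) :
    F.ContSection φ (fun _ => 0) K := fun t ht =>
  F.continuousWithinAt_etaleSpace (hφ t ht) (V := ⊤) trivial 0 (map_zero _).symm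
    (Eventually.of_forall fun _ _ => (map_zero _).symm)

lemma ContSection.add {F : Sh Y} {φ : T → Y} {s s' : ∀ t, F.presheaf.stalk (φ t)}
    {K : Set T} (h : F.ContSection φ s K) (h' : F.ContSection φ s' K) :
    F.ContSection φ (fun t => s t + s' t) K := fun t ht => by
  obtain ⟨V, hV, σ, hσ, ev⟩ := h.exists_section ht
  obtain ⟨V', hV', σ', hσ', ev'⟩ := h'.exists_section ht
  have key : ∀ (t' : T) (h1 : φ t' ∈ V) (h2 : φ t' ∈ V'),
      F.presheaf.germ (V ⊓ V') (φ t') (Opens.mem_inf.2 ⟨h1, h2⟩)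
        (F.presheaf.map (homOfLE inf_le_left).op σ + F.presheaf.map (homOfLE inf_le_right).op σ') =
      F.presheaf.germ V (φ t') h1 σ + F.presheaf.germ V' (φ t') h2 σ' := fun t' h1 h2 => by
    rw [map_add, F.presheaf.germ_res_apply, F.presheaf.germ_res_apply]
  refine F.continuousWithinAt_etaleSpace (h.continuousOn t ht) (V := V ⊓ V') ⟨hV, hV'⟩
    (F.presheaf.map (homOfLE inf_le_left).op σ + F.presheaf.map (homOfLE inf_le_right).op σ') ?_ ?_
  · rw [key _ hV hV', hσ, hσ']
  · filter_upwards [ev, ev'] with t' h1 h2 h3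
    rw [key _ h3.1 h3.2, h1.2, h2.2]

lemma ContSection.map {F G : Sh Y} (a : F ⟶ G) {φ : T → Y} {s : ∀ t, F.presheaf.stalk (φ t)}
    {K : Set T} (h : F.ContSection φ s K) :
    G.ContSection φ (fun t => (TopCat.Presheaf.stalkFunctor _ (φ t)).map a.hom (s t)) K :=
    fun t ht => by
  obtain ⟨V, hV, σ, hσ, ev⟩ := h.exists_section ht
  refine G.continuousWithinAt_etaleSpace (h.continuousOn t ht) hV (a.hom.app (op V) σ) ?_ ?_
  · rw [hσ]
    exact TopCat.Presheaf.stalkFunctor_map_germ_apply V (φ t) hV a.hom σ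
  · filter_upwards [ev] with t' h1 h2
    rw [h1.2]
    exact TopCat.Presheaf.stalkFunctor_map_germ_apply V (φ t') h2 a.hom σ

lemma ContSection.neg {F : Sh Y} {φ : T → Y} {s : ∀ t, F.presheaf.stalk (φ t)}
    {K : Set T} (h : F.ContSection φ s K) : F.ContSection φ (fun t => - s t) K := fun t ht => by
  obtain ⟨V, hV, σ, hσ, ev⟩ := h.exists_section ht
  refine F.continuousWithinAt_etaleSpace (h.continuousOn t ht) hV (-σ) ?_ ?_
  · rw [map_neg, hσ]
  · filter_upwards [ev] with t' h1 h2
    rw [h1.2, map_neg]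

lemma ContSection.sub {F : Sh Y} {φ : T → Y} {s s' : ∀ t, F.presheaf.stalk (φ t)}
    {K : Set T} (h : F.ContSection φ s K) (h' : F.ContSection φ s' K) :
    F.ContSection φ (fun t => s t - s' t) K :=
  (h.add h'.neg).congr fun _ _ => sub_eq_add_neg _ _

lemma contSection_germ (F : Sh Y) {V : Opens Y} (σ : F.presheaf.obj (op V)) {φ : T → Y} {K : Set T}
    (hφ : ContinuousOn φ K) {s : ∀ t, F.presheaf.stalk (φ t)}
    (hs : ∀ t ∈ K, ∃ h : φ t ∈ V, s t = F.presheaf.germ V (φ t) h σ) : F.ContSection φ s K :=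
  fun t ht => F.continuousWithinAt_etaleSpace (hφ t ht) (hs t ht).1 σ (hs t ht).2
    (eventually_mem_nhdsWithin.mono fun t' ht' _ => (hs t' ht').2)

/-- Continuous sections over an open subset are sections of the sheaf. -/
lemma ContSection.exists_germ_eq {F : Sh Y} {r : ∀ y, F.presheaf.stalk y} {O : Opens Y}
    (h : F.ContSection id r O) :
    ∃ σ : F.presheaf.obj (op O), ∀ (y : Y) (hy : y ∈ O), F.presheaf.germ O y hy σ = r y := by
  have key : ∀ y : O, ∃ (V : Opens Y) (_ : y.1 ∈ V) (_ : V ≤ O) (σ : F.presheaf.obj (op V)),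
      ∀ (z : Y) (hz : z ∈ V), F.presheaf.germ V z hz σ = r z := fun y => by
    obtain ⟨V, hV, σ, -, ev⟩ := h.exists_section y.2
    rw [O.isOpen.nhdsWithin_eq y.2] at ev
    obtain ⟨N, hN, hNo, hyN⟩ := eventually_nhds_iff.1 ev
    have hle : (⟨N, hNo⟩ ⊓ O : Opens Y) ≤ V := fun z hz => (hN z hz.1).1
    refine ⟨⟨N, hNo⟩ ⊓ O, ⟨hyN, y.2⟩, inf_le_right, F.presheaf.map (homOfLE hle).op σ,
      fun z hz => ?_⟩
    rw [F.presheaf.germ_res_apply]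
    exact (hN z hz.1).2.symm
  choose V hyV hVO σ hσ using key
  -- The local sections have the prescribed germs, so they agree on overlaps and glue.
  obtain ⟨ρ, hρ, -⟩ := TopCat.Sheaf.existsUnique_gluing' F V O (fun y => homOfLE (hVO y))
    (fun y hy => Opens.mem_iSup.2 ⟨⟨y, hy⟩, hyV _⟩) σ (fun y y' => by
      apply TopCat.Presheaf.section_ext
      intro z hz
      exact ((F.presheaf.germ_res_apply _ z hz _).trans (hσ y z hz.1)).trans
        ((F.presheaf.germ_res_apply _ z hz _).trans (hσ y' z hz.2)).symm)
  refine ⟨ρ, fun y hy => ?_⟩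
  rw [← hσ ⟨y, hy⟩ y (hyV _), ← hρ ⟨y, hy⟩]
  exact (F.presheaf.germ_res_apply _ _ _ _).symm

end Sh

/-! ### Extension of sections from a fibre to a neighbourhood. -/

namespace Sh

variable {X Y : TopCat.{u}} {T : Type*} [TopologicalSpace T]

lemma ContSection.union_of_isOpen {F : Sh Y} {φ : T → Y} {s : ∀ t, F.presheaf.stalk (φ t)}
    {K L : Set T} (hK : F.ContSection φ s K) (hL : F.ContSection φ s L) (hK' : IsOpen K)
    (hL' : IsOpen L) : F.ContSection φ s (K ∪ L) :=
  ContinuousOn.union_of_isOpen hK hL hK' hL'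

lemma ContSection.isOpen_eq {F : Sh Y} {φ : T → Y} {s s' : ∀ t, F.presheaf.stalk (φ t)}
    {O : Set T} (h : F.ContSection φ s O) (h' : F.ContSection φ s' O) (hO : IsOpen O) :
    IsOpen {t | t ∈ O ∧ s t = s' t} := by
  refine isOpen_iff_mem_nhds.2 fun t ht => ?_
  have := h.eventually_eq h' ht.1 ht.2
  rw [hO.nhdsWithin_eq ht.1] at this
  filter_upwards [this, hO.mem_nhds ht.1] with t' h1 h2 using ⟨h2, h1⟩

/-- Two sections near two compact subsets, which agree on the intersection of these subsets,
yield a section near the union. -/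
lemma exists_contSection_union {F : Sh Y} {φ : T → Y} (hφ : Continuous φ)
    (hd : ∀ t t', t ≠ t' → Disjoint (𝓝 (φ t)) (𝓝 (φ t'))) {s : ∀ t, F.presheaf.stalk (φ t)}
    {C₁ C₂ : Set T} (hC₁ : IsCompact C₁) (hC₂ : IsCompact C₂) {O₁ O₂ : Opens Y}
    {r₁ r₂ : ∀ y, F.presheaf.stalk y}
    (h₁ : F.ContSection id r₁ O₁) (h₂ : F.ContSection id r₂ O₂)
    (e₁ : ∀ t ∈ C₁, φ t ∈ O₁ ∧ r₁ (φ t) = s t) (e₂ : ∀ t ∈ C₂, φ t ∈ O₂ ∧ r₂ (φ t) = s t) :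
    ∃ (O : Opens Y) (r : ∀ y, F.presheaf.stalk y), F.ContSection id r O ∧
      ∀ t ∈ C₁ ∪ C₂, φ t ∈ O ∧ r (φ t) = s t := by
  classical
  -- The open locus where both sections are defined and agree. It contains the image of `C₁ ∩ C₂`,
  -- so what remains of `C₁` and `C₂` outside it has images that can be separated in `Y`.
  let E : Set Y := {y | y ∈ (O₁ : Set Y) ∩ O₂ ∧ r₁ y = r₂ y}
  have hE : IsOpen E := (h₁.mono Set.inter_subset_left).isOpen_eq (h₂.mono Set.inter_subset_right)
    (O₁.isOpen.inter O₂.isOpen)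
  have hD : Disjoint (𝓝ˢ (φ '' (C₁ \ φ ⁻¹' E))) (𝓝ˢ (φ '' (C₂ \ φ ⁻¹' E))) := by
    rw [((hC₁.diff (hE.preimage hφ)).image hφ).disjoint_nhdsSet_left]
    rintro _ ⟨t, ht, rfl⟩
    rw [((hC₂.diff (hE.preimage hφ)).image hφ).disjoint_nhdsSet_right]
    rintro _ ⟨t', ht', rfl⟩
    refine hd t t' ?_
    rintro rfl
    exact ht.2 ⟨⟨(e₁ t ht.1).1, (e₂ t ht'.1).1⟩, (e₁ t ht.1).2.trans (e₂ t ht'.1).2.symm⟩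
  obtain ⟨A₁, A₂, hA₁, hA₂, hs₁, hs₂, hA⟩ := separatedNhds_iff_disjoint.2 hD
  -- Since `A₁` and `A₂` are disjoint, `B₁ ∩ B₂` lies in `E`, where `r₁ = r₂`; hence the family that
  -- is `r₁` on `B₁` and `r₂` elsewhere is continuous on `B₁ ∪ B₂`.
  let B₁ : Set Y := A₁ ∩ O₁ ∪ E
  let B₂ : Set Y := A₂ ∩ O₂
  have hB₁ : IsOpen B₁ := (hA₁.inter O₁.isOpen).union hE
  have hB₂ : IsOpen B₂ := hA₂.inter O₂.isOpen
  let r : ∀ y, F.presheaf.stalk y := fun y => if y ∈ B₁ then r₁ y else r₂ y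
  have hr₁ : ∀ y ∈ B₁, r y = r₁ y := fun y hy => if_pos hy
  have hr₂ : ∀ y ∈ B₂, r y = r₂ y := fun y hy => by
    by_cases hy₁ : y ∈ B₁
    · rw [hr₁ y hy₁]
      rcases hy₁ with hy₁ | hy₁
      · exact (Set.disjoint_left.1 hA hy₁.1 hy.1).elim
      · exact hy₁.2
    · exact if_neg hy₁
  have hBO : B₁ ⊆ O₁ := Set.union_subset Set.inter_subset_right fun y hy => hy.1.1
  refine ⟨⟨B₁ ∪ B₂, hB₁.union hB₂⟩, r, ?_, ?_⟩
  · exact ((h₁.mono hBO).congr hr₁).union_of_isOpen ((h₂.mono Set.inter_subset_right).congr hr₂)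
      hB₁ hB₂
  · rintro t (ht | ht)
    · have : φ t ∈ B₁ := by
        by_cases hE' : φ t ∈ E
        · exact Or.inr hE'
        · exact Or.inl ⟨hs₁ ⟨t, ⟨ht, hE'⟩, rfl⟩, (e₁ t ht).1⟩
      exact ⟨Or.inl this, (hr₁ _ this).trans (e₁ t ht).2⟩
    · by_cases hE' : φ t ∈ E
      · exact ⟨Or.inl (Or.inr hE'), (hr₁ _ (Or.inr hE')).trans (hE'.2.trans (e₂ t ht).2)⟩
      · have : φ t ∈ B₂ := ⟨hs₂ ⟨t, ⟨ht, hE'⟩, rfl⟩, (e₂ t ht).1⟩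
        exact ⟨Or.inr this, (hr₂ _ this).trans (e₂ t ht).2⟩

lemma exists_contSection_of_germ (F : Sh Y) {V : Opens Y} (σ : F.presheaf.obj (op V)) :
    ∃ r : ∀ y, F.presheaf.stalk y, F.ContSection id r V ∧
      ∀ (y : Y) (hy : y ∈ V), r y = F.presheaf.germ V y hy σ := by
  classical
  refine ⟨fun y => if h : y ∈ V then F.presheaf.germ V y h σ else 0, ?_, fun y hy => dif_pos hy⟩
  exact F.contSection_germ σ continuousOn_id fun y hy => ⟨hy, dif_pos hy⟩

/-- A continuous section on a compact subset extends to an open neighbourhood. -/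
lemma ContSection.exists_extension {F : Sh Y} {φ : T → Y} (hφ : Continuous φ)
    (hd : ∀ t t', t ≠ t' → Disjoint (𝓝 (φ t)) (𝓝 (φ t'))) [LocallyCompactSpace T] {K : Set T}
    (hK : IsCompact K) {s : ∀ t, F.presheaf.stalk (φ t)} (h : F.ContSection φ s K) :
    ∃ (O : Opens Y) (r : ∀ y, F.presheaf.stalk y), F.ContSection id r O ∧
      ∀ t ∈ K, φ t ∈ O ∧ r (φ t) = s t := by
  have : T2Space T := t2Space_iff_disjoint_nhds.2 fun t t' htt' =>
    ((hφ.tendsto t).disjoint (hd t t' htt') (hφ.tendsto t'))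
  -- The set in the induction is replaced by a compact `C` between `S ∩ K` and `K`, because gluing
  -- two extensions needs compactness.
  suffices ∃ C : Set T, IsCompact C ∧ K ∩ K ⊆ C ∧ C ⊆ K ∧
      ∃ (O : Opens Y) (r : ∀ y, F.presheaf.stalk y), F.ContSection id r O ∧
        ∀ t ∈ C, φ t ∈ O ∧ r (φ t) = s t by
    obtain ⟨C, -, hKC, -, O, r, hr, e⟩ := this
    exact ⟨O, r, hr, fun t ht => e t (hKC ⟨ht, ht⟩)⟩
  refine hK.induction_on (p := fun S => ∃ C : Set T, IsCompact C ∧ S ∩ K ⊆ C ∧ C ⊆ K ∧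
      ∃ (O : Opens Y) (r : ∀ y, F.presheaf.stalk y), F.ContSection id r O ∧
        ∀ t ∈ C, φ t ∈ O ∧ r (φ t) = s t) ?_ ?_ ?_ ?_
  · exact ⟨∅, isCompact_empty, by simp, by simp, ⊥, fun _ => 0,
      F.contSection_zero continuousOn_id, by simp⟩
  · rintro S S' hS ⟨C, hC, hSC, h'⟩
    exact ⟨C, hC, (Set.inter_subset_inter_left _ hS).trans hSC, h'⟩
  · rintro S S' ⟨C, hC, hSC, hCK, O, r, hr, e⟩ ⟨C', hC', hSC', hCK', O', r', hr', e'⟩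
    refine ⟨C ∪ C', hC.union hC', ?_, Set.union_subset hCK hCK',
      exists_contSection_union hφ hd hC hC' hr hr' e e'⟩
    rw [Set.union_inter_distrib_right]
    exact Set.union_subset_union hSC hSC'
  · intro t ht
    obtain ⟨V, hV, σ, -, ev⟩ := h.exists_section ht
    obtain ⟨N, hN, hNK⟩ := mem_nhdsWithin_iff_exists_mem_nhds_inter.1 ev
    obtain ⟨C, hC, hCN, hCc⟩ := LocallyCompactSpace.local_compact_nhds t N hN
    obtain ⟨r, hr, hrσ⟩ := F.exists_contSection_of_germ σ
    refine ⟨C, mem_nhdsWithin_of_mem_nhds hC, C ∩ K, hCc.inter_right hK.isClosed, subset_rfl,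
      Set.inter_subset_right, V, r, hr, fun t' ht' => ?_⟩
    obtain ⟨hV', e⟩ := hNK ⟨hCN ht'.1, ht'.2⟩
    exact ⟨hV', (hrσ _ hV').trans e.symm⟩

/-- The support is proper over `U` and misses the fibre over `x`, so it misses the preimage of a
neighbourhood of `x`. -/
lemma properSections_eq_zero_of_fiber (f : Y ⟶ X) (F : Sh Y) {U : Opens X} {x : X} (hx : x ∈ U)
    {σ : F.presheaf.obj (op ((Opens.map f).obj U))} (hσ : σ ∈ properSections f F U)
    (h : ∀ (y : Y) (hy : f y ∈ U), f y = x →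
      F.presheaf.germ ((Opens.map f).obj U) y hy σ = 0) :
    ∃ (V : Opens X) (i : V ⟶ U), x ∈ V ∧ F.presheaf.map ((Opens.map f).map i).op σ = 0 := by
  obtain ⟨V, hV, hxV, hVσ⟩ := ProperOver.eventually_notMem f.hom.continuous hσ hx
    (fun y hy hyx => hy.2 (h y hy.1 hyx))
  refine ⟨⟨V, hV⟩ ⊓ U, homOfLE inf_le_right, ⟨hxV, hx⟩, ?_⟩
  apply TopCat.Presheaf.section_ext
  intro y hy
  by_contra hn
  have : y ∈ F.supp (F.presheaf.map ((Opens.map f).map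
      (homOfLE inf_le_right : ⟨V, hV⟩ ⊓ U ⟶ U)).op σ) := ⟨hy, by simpa using hn⟩
  rw [supp_map] at this
  exact hVσ y this.1 hy.1

/-- A continuous section with compact support on a fiber of a separated and locally proper map
is the restriction of a section of the proper direct image. -/
lemma exists_properSections_of_fiber {f : Y ⟶ X} (hf : IsSeparatedMap f) (hf' : IsLocallyProper f)
    (F : Sh Y) {x : X} [LocallyCompactSpace T] {φ : T → Y} (hφ : IsEmbedding φ)
    (hφx : Set.range φ = f ⁻¹' {x}) {s : ∀ t, F.presheaf.stalk (φ t)}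
    (hs : F.ContSection φ s Set.univ) {K : Set T}
    (hK : IsCompact K) (hsK : ∀ t ∉ K, s t = 0) :
    ∃ (U : Opens X) (_ : x ∈ U), ∃ σ ∈ properSections f F U,
      ∀ (t : T) (ht : φ t ∈ (Opens.map f).obj U), F.presheaf.germ _ (φ t) ht σ = s t := by
  classical
  have hmem : ∀ t, f (φ t) = x := fun t => hφx.subset ⟨t, rfl⟩
  have hc : Continuous f := f.hom.continuous
  obtain ⟨A, U₀, hKA, hU₀, hxU₀, hA⟩ := hf'.exists_properOver_of_isCompact
    (hK.image hφ.continuous) (x := x) (by rintro _ ⟨t, -, rfl⟩; exact hmem t)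
  have hAx : IsCompact (φ ⁻¹' A) := by
    rw [hφ.isCompact_iff, Set.image_preimage_eq_inter_range, hφx]
    exact hA.isCompact_inter_fiber hc hxU₀
  -- The extension starts from the whole compact set `A ∩ f⁻¹(x)`, not just `K`: at its points
  -- outside `K` the germ of `r` is zero, which makes the later extension by zero possible.
  obtain ⟨O, r, hr, hrs⟩ := (hs.mono (Set.subset_univ _)).exists_extension
    hφ.continuous (fun t t' htt' => hf.disjoint_nhds ((hmem t).trans (hmem t').symm)
      (fun e => htt' (hφ.injective e))) hAx
  -- The open set of good points: inside `interior A` with `r` defined, or with `r` zero. It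
  -- contains `A ∩ f⁻¹(x)`, and `A \ G` is proper over `U₀`, so over a smaller base all of `A` is
  -- good.
  let G : Set Y := (O ∩ interior A) ∪ {y | y ∈ (O : Set Y) ∧ r y = 0}
  have hG : IsOpen G := (O.isOpen.inter isOpen_interior).union
    (hr.isOpen_eq (F.contSection_zero continuousOn_id) O.isOpen)
  have hAG : ProperOver f (A \ G) U₀ := hA.mono hc Set.sdiff_subset subset_rfl
    (fun y hy => ((properOver_iff hc).1 hA).1 hy.1) (fun y hy _ hyG => by
      have : y ∈ G := by by_contra h; exact hyG ⟨hy, h⟩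
      exact mem_of_superset (hG.mem_nhds this) fun z hz hz' => hz'.2 hz)
  obtain ⟨U₁, hU₁, hxU₁, hU₁A⟩ := hAG.eventually_notMem hc hxU₀ (fun y hy hyx => by
    refine hy.2 ?_
    obtain ⟨t, rfl⟩ := hφx.symm.subset hyx
    have h1 := hrs t hy.1
    by_cases hyA : φ t ∈ interior A
    · exact Or.inl ⟨h1.1, hyA⟩
    · exact Or.inr ⟨h1.1, h1.2.trans (hsK _ fun h => hyA (hKA ⟨_, h, rfl⟩))⟩)
  let U : Opens X := ⟨U₀ ∩ U₁, hU₀.inter hU₁⟩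
  have hUG : ∀ y ∈ A, f y ∈ U → y ∈ G := fun y hy hyU => by
    by_contra h
    exact hU₁A y ⟨hy, h⟩ hyU.2
  -- Extension by zero. The preimage of `U` is covered by three open sets on which `r'` is
  -- continuous: the part in `interior A`, the locus where `r` is zero, and the interior of the
  -- complement of `A`. The cover uses that `A` is closed over `U₀`.
  let r' : ∀ y, F.presheaf.stalk y := fun y => if y ∈ interior A then r y else 0
  have hr'O : F.ContSection id r' ((Opens.map f).obj U : Opens Y) := by
    have h1 : F.ContSection id r' (((Opens.map f).obj U : Opens Y) ∩ interior A) := by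
      refine (hr.mono ?_).congr (fun y hy => if_pos hy.2)
      rintro y ⟨hyU, hyA⟩
      rcases hUG y (interior_subset hyA) hyU with h | h
      exacts [h.1, h.1]
    have h2 : F.ContSection id r' {y | y ∈ (O : Set Y) ∧ r y = 0} :=
      (F.contSection_zero continuousOn_id).congr fun y hy => by
        by_cases hyA : y ∈ interior A
        · exact (if_pos hyA).trans hy.2
        · exact if_neg hyA
    have h3 : F.ContSection id r' (interior Aᶜ) :=
      (F.contSection_zero continuousOn_id).congr fun y hy => if_neg fun hyA =>
        interior_subset hy (interior_subset hyA)
    refine ((h1.union_of_isOpen h2 (((Opens.map f).obj U).isOpen.inter isOpen_interior)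
      (hr.isOpen_eq (F.contSection_zero continuousOn_id) O.isOpen)).union_of_isOpen h3
      ((((Opens.map f).obj U).isOpen.inter isOpen_interior).union
        (hr.isOpen_eq (F.contSection_zero continuousOn_id) O.isOpen)) isOpen_interior).mono ?_
    intro y hy
    by_cases hyA : y ∈ A
    · rcases hUG y hyA hy with h | h
      · exact Or.inl (Or.inl ⟨hy, h.2⟩)
      · exact Or.inl (Or.inr h)
    · exact Or.inr (mem_interior_iff_mem_nhds.2 (hA.compl_mem_nhds hc hf hy.1 hyA))
  obtain ⟨σ, hσ⟩ := hr'O.exists_germ_eq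
  refine ⟨U, ⟨hxU₀, hxU₁⟩, σ, ?_, fun t ht => ?_⟩
  · refine hA.mono hc ?_ Set.inter_subset_left (F.supp_subset _)
      fun _ _ hy hy' => F.compl_supp_mem_nhds _ hy hy'
    rintro y ⟨hy, hne⟩
    rw [hσ y hy] at hne
    by_contra hyA
    exact hne (if_neg fun h => hyA (interior_subset h))
  · rw [hσ]
    by_cases htA : φ t ∈ interior A
    · exact (if_pos htA).trans (hrs t (show φ t ∈ A from interior_subset htA)).2
    · exact (if_neg htA).trans (hsK t fun h => htA (hKA ⟨_, h, rfl⟩)).symm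

/-- The restriction of a section of the proper direct image to a fiber has compact support. -/
lemma exists_fiber_of_properSections (f : Y ⟶ X) (F : Sh Y) {U : Opens X} {x : X} (hx : x ∈ U)
    {σ : F.presheaf.obj (op ((Opens.map f).obj U))} (hσ : σ ∈ properSections f F U)
    {s : ∀ t : f ⁻¹' {x}, F.presheaf.stalk t.1}
    (hs : ∀ (t : f ⁻¹' {x}) (ht : t.1 ∈ (Opens.map f).obj U), s t = F.presheaf.germ _ t.1 ht σ) :
    F.ContSection (fun t : f ⁻¹' {x} => t.1) s Set.univ ∧
      ∃ K : Set (f ⁻¹' {x}), IsCompact K ∧ ∀ t ∉ K, s t = 0 := by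
  have hmem : ∀ t : f ⁻¹' {x}, t.1 ∈ (Opens.map f).obj U := fun t => by
    change f t.1 ∈ U
    rw [show f t.1 = x from t.2]
    exact hx
  refine ⟨F.contSection_germ σ continuous_subtype_val.continuousOn
    fun t _ => ⟨hmem t, hs t (hmem t)⟩, Subtype.val ⁻¹' (F.supp σ), ?_, fun t ht => ?_⟩
  · rw [Subtype.isCompact_iff, Subtype.image_preimage_coe, Set.inter_comm]
    exact ProperOver.isCompact_inter_fiber f.hom.continuous hσ hx
  · by_contra hn
    exact ht ⟨hmem t, fun h => hn ((hs t (hmem t)).trans h)⟩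

end Sh

/-! ### Stalks and sections of the inverse image. -/

namespace Sh

variable {X Y W Z : TopCat.{u}} {T : Type*} [TopologicalSpace T]

/-- The pullback of sections of `F` to sections of the inverse image of `F`. -/
noncomputable def pullSection (q : W ⟶ Y) (F : Sh Y) (U : Opens Y) :
    F.presheaf.obj (op U) ⟶
      ((inverseImage q).obj F).presheaf.obj (op ((Opens.map q).obj U)) :=
  ((TopCat.Sheaf.pullbackPushforwardAdjunction AddCommGrpCat.{u} q).unit.app F).hom.app (op U)

/-- The canonical map from the stalk of `F` at `q w` to the stalk of its inverse image at `w`. -/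
noncomputable def stalkPull (q : W ⟶ Y) (F : Sh Y) (w : W) :
    F.presheaf.stalk (q w) ⟶ ((inverseImage q).obj F).presheaf.stalk w :=
  (TopCat.Presheaf.stalkFunctor _ (q w)).map
    ((TopCat.Sheaf.pullbackPushforwardAdjunction AddCommGrpCat.{u} q).unit.app F).hom ≫
    TopCat.Presheaf.stalkPushforward _ q ((inverseImage q).obj F).presheaf w

lemma germ_stalkPull (q : W ⟶ Y) (F : Sh Y) (w : W) (U : Opens Y) (hU : q w ∈ U) :
    F.presheaf.germ U (q w) hU ≫ stalkPull q F w =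
      pullSection q F U ≫ ((inverseImage q).obj F).presheaf.germ ((Opens.map q).obj U) w hU := by
  let a := ((TopCat.Sheaf.pullbackPushforwardAdjunction AddCommGrpCat.{u} q).unit.app F).hom
  have h := TopCat.Presheaf.stalkFunctor_map_germ_assoc U (q w) hU a
    (TopCat.Presheaf.stalkPushforward _ q ((inverseImage q).obj F).presheaf w)
  exact h.trans (congrArg (pullSection q F U ≫ ·)
    (TopCat.Presheaf.stalkPushforward_germ _ q ((inverseImage q).obj F).presheaf U w hU))

lemma germ_pullSection (q : W ⟶ Y) (F : Sh Y) (w : W) {U : Opens Y} (hU : q w ∈ U)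
    (σ : F.presheaf.obj (op U)) :
    ((inverseImage q).obj F).presheaf.germ ((Opens.map q).obj U) w hU (pullSection q F U σ) =
      stalkPull q F w (F.presheaf.germ U (q w) hU σ) :=
  (ConcreteCategory.congr_hom (germ_stalkPull q F w U hU) σ).symm

-- Maps from a stalk to `A` are maps to the skyscraper sheaf with value `A`, and the direct image
-- along `q` of the skyscraper at `w` is the skyscraper at `q w`. By adjunction, `stalkPull`
-- therefore induces bijections on maps into every `A`.
open StalkSkyscraperPresheafAdjunctionAuxs in
instance (q : W ⟶ Y) (F : Sh Y) (w : W) : IsIso (stalkPull q F w) := by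
  let _ : ∀ U : Opens W, Decidable (w ∈ U) := fun _ => Classical.dec _
  -- This choice makes the direct image of the skyscraper at `w` definitionally the skyscraper at `q
  -- w`.
  let _ : ∀ U : Opens Y, Decidable (q w ∈ U) := fun U =>
    inferInstanceAs (Decidable (w ∈ (Opens.map q).obj U))
  let adj := TopCat.Sheaf.pullbackPushforwardAdjunction AddCommGrpCat.{u} q
  apply isIso_of_coyoneda_map_bijective
  intro A
  constructor
  · intro a b hab
    let a' : (inverseImage q).obj F ⟶ skyscraperSheaf w A := ⟨toSkyscraperPresheaf w a⟩
    let b' : (inverseImage q).obj F ⟶ skyscraperSheaf w A := ⟨toSkyscraperPresheaf w b⟩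
    have : a' = b' := by
      apply (adj.homEquiv _ _).injective
      rw [adj.homEquiv_unit, adj.homEquiv_unit]
      apply ObjectProperty.hom_ext
      apply NatTrans.ext
      funext ⟨U⟩
      by_cases hU : q w ∈ U
      · have h1 : ∀ c : ((inverseImage q).obj F).presheaf.stalk w ⟶ A,
            pullSection q F U ≫ (toSkyscraperPresheaf w c).app (op ((Opens.map q).obj U)) =
              F.presheaf.germ U (q w) hU ≫ stalkPull q F w ≫ c ≫ eqToHom (if_pos hU).symm :=
            fun c => by
          rw [toSkyscraperPresheaf_app]
          erw [dif_pos hU]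
          rw [← Category.assoc, ← germ_stalkPull, Category.assoc]
          rfl
        refine (h1 a).trans (Eq.trans ?_ (h1 b).symm)
        rw [reassoc_of% (show stalkPull q F w ≫ a = stalkPull q F w ≫ b from hab)]
      · exact (isTerminalSkyscraperSheafObjObjOfNotMem (p₀ := w) (A := A)
          (U := op ((Opens.map q).obj U)) hU).hom_ext _ _
    have h2 : toSkyscraperPresheaf w a = toSkyscraperPresheaf w b :=
      congrArg (fun c => c.hom) this
    rw [← fromStalk_to_skyscraper w a, h2, fromStalk_to_skyscraper]
  · intro c
    let c' : F ⟶ (directImage q).obj (skyscraperSheaf w A) :=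
      ⟨(toSkyscraperPresheaf (q w) c : F.presheaf ⟶ skyscraperPresheaf (q w) A)⟩
    let d : (inverseImage q).obj F ⟶ skyscraperSheaf w A := (adj.homEquiv _ _).symm c'
    have hd : ∀ U : Opens Y, pullSection q F U ≫ d.hom.app (op ((Opens.map q).obj U)) =
        c'.hom.app (op U) := fun U => by
      have h : (adj.homEquiv _ _) d = c' := Equiv.apply_symm_apply _ _
      rw [adj.homEquiv_unit] at h
      exact congr_app (congrArg (fun c => c.hom) h) (op U)
    refine ⟨fromStalk w d.hom, ?_⟩
    apply F.presheaf.stalk_hom_ext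
    intro U hU
    dsimp only
    rw [← Category.assoc, germ_stalkPull, Category.assoc]
    refine (congrArg (pullSection q F U ≫ ·)
      (germ_fromStalk w d.hom ((Opens.map q).obj U) hU)).trans ?_
    refine (Category.assoc _ _ _).symm.trans ((congrArg (· ≫ eqToHom _) (hd U)).trans ?_)
    exact (germ_fromStalk (q w) (toSkyscraperPresheaf (q w) c) U hU).symm.trans
      (congrArg (F.presheaf.germ U (q w) hU ≫ ·) (fromStalk_to_skyscraper (q w) c))

lemma stalkPull_bijective (q : W ⟶ Y) (F : Sh Y) (w : W) : Function.Bijective (stalkPull q F w) :=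
  ConcreteCategory.bijective_of_isIso _

/-- Sections of the inverse image `q^(*)F` along `ψ` are sections of `F` along `q ∘ ψ`. -/
lemma contSection_stalkPull_iff (q : W ⟶ Y) (F : Sh Y) {ψ : T → W} {K : Set T}
    (hψ : ContinuousOn ψ K) (s : ∀ t, F.presheaf.stalk (q (ψ t))) :
    ((inverseImage q).obj F).ContSection ψ (fun t => stalkPull q F (ψ t) (s t)) K ↔
      F.ContSection (fun t => q (ψ t)) s K := by
  constructor
  · intro h t ht
    obtain ⟨V, hV, σ, hσ⟩ := F.presheaf.exists_germ_eq (s t)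
    refine F.continuousWithinAt_etaleSpace (q.hom.continuous.comp_continuousOn hψ t ht) hV σ
      hσ.symm ?_
    -- The pullbacks of `s` and of the germs of `σ` are continuous and agree at `t`, hence nearby;
    -- injectivity of `stalkPull` brings the equality back to `F`.
    obtain ⟨r', -, hr'⟩ := F.exists_contSection_of_germ σ
    let r : ∀ t, F.presheaf.stalk (q (ψ t)) := fun t' => r' (q (ψ t'))
    have hr : ((inverseImage q).obj F).ContSection ψ (fun t => stalkPull q F (ψ t) (r t))
        (K ∩ (fun t => q (ψ t)) ⁻¹' V) :=
      contSection_germ _ (V := (Opens.map q).obj V) (pullSection q F V σ)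
        (hψ.mono Set.inter_subset_left) fun t' ht' => ⟨ht'.2, by
          rw [germ_pullSection q F (ψ t') ht'.2]
          exact congrArg _ (hr' _ ht'.2)⟩
    have hev := (h.mono Set.inter_subset_left).eventually_eq hr ⟨ht, hV⟩
      (congrArg _ (hσ.symm.trans (hr' _ hV).symm))
    have hK : K ∩ (fun t => q (ψ t)) ⁻¹' V ∈ 𝓝[K] t :=
      inter_mem self_mem_nhdsWithin
        ((q.hom.continuous.comp_continuousOn hψ t ht).preimage_mem_nhdsWithin
          (V.isOpen.mem_nhds hV))
    rw [nhdsWithin_inter_of_mem' (mem_of_superset hK Set.inter_subset_right)] at hev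
    filter_upwards [hev] with t' ht' hV'
    exact ((stalkPull_bijective q F _).1 ht').trans (hr' _ hV')
  · intro h t ht
    obtain ⟨V, hV, σ, hσ, ev⟩ := h.exists_section ht
    refine continuousWithinAt_etaleSpace _ (hψ t ht) (V := (Opens.map q).obj V) hV
      (pullSection q F V σ) ?_ ?_
    · rw [germ_pullSection q F (ψ t) hV, hσ]
    · filter_upwards [ev] with t' ht' hV'
      rw [germ_pullSection q F (ψ t') hV', ht'.2]

/-- The inverse image of a section of `f_(!)F`, as a section of `g_(!)q^(*)F`. -/
lemma pullSection_baseChange {f : Y ⟶ X} {q : W ⟶ Y} {p : Z ⟶ X} {g : W ⟶ Z}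
    (sq : IsPullback q g f p) (F : Sh Y) (U : Opens X)
    (σ : ((properDirectImage f).obj F).presheaf.obj (op U)) :
    ((baseChange sq).app F).hom.app (op ((Opens.map p).obj U))
        (pullSection p ((properDirectImage f).obj F) U σ) =
      (⟨((inverseImage q).obj F).presheaf.map (opensHom sq.w U).op
        (pullSection q F ((Opens.map f).obj U) σ.1),
        baseChange_mem sq _ U (hom_mem_properSections f
          ((TopCat.Sheaf.pullbackPushforwardAdjunction AddCommGrpCat.{u} q).unit.app F) σ.2)⟩ :
        properSections g ((inverseImage q).obj F) ((Opens.map p).obj U)) := by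
  let adj := TopCat.Sheaf.pullbackPushforwardAdjunction AddCommGrpCat.{u} p
  have h : (adj.homEquiv _ _) ((baseChange sq).app F) = _ := Equiv.apply_symm_apply _ _
  rw [adj.homEquiv_unit] at h
  exact ConcreteCategory.congr_hom (congr_app (congrArg (fun c => c.hom) h) (op U)) σ

end Sh

/-! ### Fibres of a cartesian square and underived base change. -/

namespace Sh

variable {X Y W Z : TopCat.{u}}

section Fiber

variable {f : Y ⟶ X} {q : W ⟶ Y} {p : Z ⟶ X} {g : W ⟶ Z} (sq : IsPullback q g f p)

include sq in
/-- The total space of a cartesian square, as a subspace of the product. -/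
lemma exists_homeomorph_of_isPullback :
    ∃ e : W ≃ₜ {a : Y × Z // f a.1 = p a.2}, ∀ w, (e w).1.1 = q w ∧ (e w).1.2 = g w := by
  let e : W ≅ (TopCat.pullbackCone f p).pt :=
    sq.isLimit.conePointUniqueUpToIso (TopCat.pullbackConeIsLimit f p)
  have h1 : e.hom ≫ TopCat.pullbackFst f p = q :=
    sq.isLimit.conePointUniqueUpToIso_hom_comp (TopCat.pullbackConeIsLimit f p) .left
  have h2 : e.hom ≫ TopCat.pullbackSnd f p = g :=
    sq.isLimit.conePointUniqueUpToIso_hom_comp (TopCat.pullbackConeIsLimit f p) .right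
  exact ⟨(TopCat.homeoOfIso e : W ≃ₜ {a : Y × Z // f a.1 = p a.2}),
    fun w => ⟨ConcreteCategory.congr_hom h1 w, ConcreteCategory.congr_hom h2 w⟩⟩

-- The topology of `W` is induced by `q` and `g` together, and `g` is constant on the fibre, so
-- there `q` alone induces it. With `range_fiber` this identifies the fibre with one of `f`.
include sq in
lemma isEmbedding_fiber (z : Z) : IsEmbedding (fun t : g ⁻¹' {z} => q t.1) := by
  obtain ⟨e, he⟩ := exists_homeomorph_of_isPullback sq
  have hg : ∀ t : g ⁻¹' {z}, g t.1 = z := fun t => t.2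
  refine ⟨isInducing_iff_nhds.2 fun t => ?_, fun t t' h => ?_⟩
  · rw [nhds_subtype, nhds_eq_of_homeomorph e t.1, Filter.comap_inf, Filter.comap_comap,
      Filter.comap_comap]
    have h1 : (fun x => (e x).1.1) ∘ (Subtype.val : g ⁻¹' {z} → W) = fun t => q t.1 :=
      funext fun t => (he t.1).1
    have h2 : (fun x => (e x).1.2) ∘ (Subtype.val : g ⁻¹' {z} → W) = fun _ => z :=
      funext fun t => (he t.1).2.trans (hg t)
    rw [h1, h2, (he t.1).1, (he t.1).2, hg t]
    refine inf_eq_left.2 (le_trans le_top ?_)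
    rw [← map_le_iff_le_comap]
    exact (tendsto_const_nhds : Tendsto (fun _ : g ⁻¹' {z} => z) ⊤ (𝓝 z))
  · apply Subtype.ext
    apply e.injective
    apply Subtype.ext
    refine Prod.ext ?_ ?_
    · rw [(he _).1, (he _).1]
      exact h
    · rw [(he _).2, (he _).2, hg, hg]

include sq in
lemma range_fiber (z : Z) : Set.range (fun t : g ⁻¹' {z} => q t.1) = f ⁻¹' {p z} := by
  obtain ⟨e, he⟩ := exists_homeomorph_of_isPullback sq
  have hw : ∀ x : W, f (q x) = p (g x) := fun x => ConcreteCategory.congr_hom sq.w x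
  refine Set.Subset.antisymm ?_ ?_
  · rintro _ ⟨t, rfl⟩
    exact (hw t.1).trans (congrArg p t.2)
  · intro y hy
    obtain ⟨w, hw⟩ := e.surjective ⟨(y, z), hy⟩
    refine ⟨⟨w, ?_⟩, ?_⟩
    · change g w = z
      rw [← (he w).2, hw]
    · change q w = y
      rw [← (he w).1, hw]

end Fiber

/-- A germ of the proper direct image vanishes if it vanishes on the fiber. -/
lemma germ_properDirectImage_eq_zero (f : Y ⟶ X) (F : Sh Y) {U : Opens X} {x : X} (hx : x ∈ U)
    (σ : properSections f F U)
    (h : ∀ (y : Y) (hy : f y ∈ U), f y = x →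
      F.presheaf.germ ((Opens.map f).obj U) y hy σ.1 = 0) :
    ((properDirectImage f).obj F).presheaf.germ U x hx σ = 0 := by
  obtain ⟨V, i, hxV, e⟩ := properSections_eq_zero_of_fiber f F hx σ.2 h
  have h1 : ((properDirectImage f).obj F).presheaf.map i.op σ = 0 := Subtype.ext e
  refine (((properDirectImage f).obj F).presheaf.germ_res_apply i x hxV σ).symm.trans ?_
  exact (congrArg _ h1).trans (map_zero _)

/-- The germs on the fiber of a germ of the proper direct image. -/
lemma germ_eq_zero_of_germ_properDirectImage (f : Y ⟶ X) (F : Sh Y) {U : Opens X} {x : X}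
    (hx : x ∈ U) (σ : properSections f F U)
    (h : ((properDirectImage f).obj F).presheaf.germ U x hx σ = 0) (y : Y) (hy : f y ∈ U)
    (hyx : f y = x) : F.presheaf.germ ((Opens.map f).obj U) y hy σ.1 = 0 := by
  obtain ⟨V, hV, i, j, e⟩ := ((properDirectImage f).obj F).presheaf.germ_eq x hx hx σ 0
    (h.trans (map_zero _).symm)
  have e' : F.presheaf.map ((Opens.map f).map i).op σ.1 = 0 :=
    (congrArg Subtype.val e).trans (congrArg Subtype.val (map_zero _))
  have hyV : y ∈ (Opens.map f).obj V := by
    change f y ∈ V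
    rwa [hyx]
  refine (F.presheaf.germ_res_apply ((Opens.map f).map i) y hyV σ.1).symm.trans ?_
  exact (congrArg _ e').trans (map_zero _)

/-- The vanishing criterion is applied to the difference on `U ⊓ V`: a germ of `f_(!) F` is
determined by its germs on the fibre. -/
lemma germ_properDirectImage_eq (f : Y ⟶ X) (F : Sh Y) {U V : Opens X} {x : X} (hU : x ∈ U)
    (hV : x ∈ V) (σ : properSections f F U) (τ : properSections f F V)
    (h : ∀ (y : Y) (hyU : f y ∈ U) (hyV : f y ∈ V), f y = x →
      F.presheaf.germ ((Opens.map f).obj U) y hyU σ.1 =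
        F.presheaf.germ ((Opens.map f).obj V) y hyV τ.1) :
    ((properDirectImage f).obj F).presheaf.germ U x hU σ =
      ((properDirectImage f).obj F).presheaf.germ V x hV τ := by
  let P := ((properDirectImage f).obj F).presheaf
  let i : U ⊓ V ⟶ U := homOfLE inf_le_left
  let j : U ⊓ V ⟶ V := homOfLE inf_le_right
  have hN : x ∈ U ⊓ V := ⟨hU, hV⟩
  refine (P.germ_res_apply i x hN σ).symm.trans (Eq.trans ?_ (P.germ_res_apply j x hN τ))
  rw [← sub_eq_zero, ← map_sub]
  refine germ_properDirectImage_eq_zero f F hN _ fun y hyN hyx => ?_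
  refine (map_sub (F.presheaf.germ ((Opens.map f).obj (U ⊓ V)) y hyN).hom _ _).trans ?_
  rw [sub_eq_zero]
  exact (F.presheaf.germ_res_apply ((Opens.map f).map i) y hyN σ.1).trans
    ((h y hyN.1 hyN.2 hyx).trans (F.presheaf.germ_res_apply ((Opens.map f).map j) y hyN τ.1).symm)

/-- The proper base change morphism is an isomorphism. -/
lemma isIso_baseChange {f : Y ⟶ X} {q : W ⟶ Y} {p : Z ⟶ X} {g : W ⟶ Z}
    (sq : IsPullback q g f p) (hf : IsSeparatedMap f) (hf' : IsLocallyProper f)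
    (hg' : IsLocallyProper g) : IsIso (baseChange sq) := by
  suffices ∀ F, IsIso ((baseChange sq).app F) from NatIso.isIso_of_isIso_app _
  intro F
  have hw : ∀ x : W, f (q x) = p (g x) := fun x => ConcreteCategory.congr_hom sq.w x
  rw [TopCat.Presheaf.isIso_iff_stalkFunctor_map_iso]
  intro z
  have := hg'.locallyCompactSpace_fiber z
  let G := (inverseImage q).obj F
  let b : ((inverseImage p).obj ((properDirectImage f).obj F)).presheaf.stalk z ⟶
      ((properDirectImage g).obj G).presheaf.stalk z :=
    (TopCat.Presheaf.stalkFunctor AddCommGrpCat.{u} z).map ((baseChange sq).app F).hom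
  -- the base change of a section of `f_(!)F`
  have key : ∀ (U : Opens X) (hU : p z ∈ U) (σ : properSections f F U),
      ∃ τ : properSections g G ((Opens.map p).obj U),
        (∀ (w : W) (h : p (g w) ∈ U), G.presheaf.germ _ w h τ.1 =
          stalkPull q F w (F.presheaf.germ ((Opens.map f).obj U) (q w)
            (show f (q w) ∈ U by rwa [hw]) σ.1)) ∧
        b (stalkPull p ((properDirectImage f).obj F) z
          (((properDirectImage f).obj F).presheaf.germ U (p z) hU σ)) =
          ((properDirectImage g).obj G).presheaf.germ ((Opens.map p).obj U) z hU τ := by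
    intro U hU σ
    refine ⟨⟨G.presheaf.map (opensHom sq.w U).op (pullSection q F ((Opens.map f).obj U) σ.1),
      baseChange_mem sq _ U (hom_mem_properSections f
        ((TopCat.Sheaf.pullbackPushforwardAdjunction AddCommGrpCat.{u} q).unit.app F) σ.2)⟩,
      fun w h => ?_, ?_⟩
    rotate_left
    · rw [← germ_pullSection p ((properDirectImage f).obj F) z hU σ]
      refine (TopCat.Presheaf.stalkFunctor_map_germ_apply ((Opens.map p).obj U) z hU
        ((baseChange sq).app F).hom _).trans ?_
      exact congrArg _ (pullSection_baseChange sq F U σ)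
    · refine (G.presheaf.germ_res_apply (opensHom sq.w U) w h _).trans ?_
      exact germ_pullSection q F w (U := (Opens.map f).obj U) _ σ.1
  -- Every point of the fibre of `f` over `p z` comes from the fibre of `g` over `z`, where
  -- `stalkPull` detects zero germs.
  have hinj : ∀ a, b (stalkPull p ((properDirectImage f).obj F) z a) = 0 → a = 0 := by
    intro a ha
    obtain ⟨U, hU, σ, rfl⟩ := ((properDirectImage f).obj F).presheaf.exists_germ_eq a
    obtain ⟨τ, hτ, e⟩ := key U hU σ
    rw [e] at ha
    refine germ_properDirectImage_eq_zero f F hU σ fun y hy hyx => ?_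
    obtain ⟨t, rfl⟩ := (range_fiber sq z).symm.subset hyx
    have hgt : g t.1 = z := t.2
    have h1 := germ_eq_zero_of_germ_properDirectImage g G (U := (Opens.map p).obj U) hU τ ha t.1
      (by change p (g t.1) ∈ U; rwa [hgt]) hgt
    rw [hτ t.1 (by rwa [hgt])] at h1
    exact (stalkPull_bijective q F t.1).1 (h1.trans (map_zero _).symm)
  have hsurj : ∀ c, ∃ a, b (stalkPull p ((properDirectImage f).obj F) z a) = c := by
    intro c
    obtain ⟨V, hV, τ, rfl⟩ := ((properDirectImage g).obj G).presheaf.exists_germ_eq c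
    have hmem : ∀ t : g ⁻¹' {z}, t.1 ∈ (Opens.map g).obj V := fun t => by
      change g t.1 ∈ V
      rwa [show g t.1 = z from t.2]
    -- The restriction of `τ` to the fibre is transported germ by germ to a compactly supported
    -- section of `F` on the fibre of `f` over `p z`, which extends to a section of `f_(!) F` near
    -- `p z`.
    choose s hs using fun t : g ⁻¹' {z} => (stalkPull_bijective q F t.1).2
      (G.presheaf.germ _ t.1 (hmem t) τ.1)
    obtain ⟨hc, K, hK, hsK⟩ := exists_fiber_of_properSections g G hV τ.2
      (s := fun t => stalkPull q F t.1 (s t)) fun t ht => hs t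
    rw [contSection_stalkPull_iff q F continuous_subtype_val.continuousOn] at hc
    obtain ⟨U, hU, σ, hσ, hσs⟩ := exists_properSections_of_fiber hf hf' F (isEmbedding_fiber sq z)
      (range_fiber sq z) hc hK (fun t ht => (stalkPull_bijective q F t.1).1
        ((hsK t ht).trans (map_zero _).symm))
    obtain ⟨τ', hτ', e⟩ := key U hU ⟨σ, hσ⟩
    refine ⟨_, e.trans ?_⟩
    refine germ_properDirectImage_eq g G (U := (Opens.map p).obj U) hU hV τ' τ
      fun w hwU hwV hwz => ?_
    refine (hτ' w hwU).trans ?_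
    refine Eq.trans ?_ (hs ⟨w, hwz⟩)
    exact congrArg _ (hσs ⟨w, hwz⟩ _)
  have hb : Function.Bijective b := by
    constructor
    · refine (injective_iff_map_eq_zero b.hom).2 fun a ha => ?_
      obtain ⟨a, rfl⟩ := (stalkPull_bijective p ((properDirectImage f).obj F) z).2 a
      exact (congrArg _ (hinj a ha)).trans (map_zero _)
    · intro c
      obtain ⟨a, ha⟩ := hsurj c
      exact ⟨_, ha⟩
  exact (ConcreteCategory.isIso_iff_bijective b).2 hb

end Sh

/-! ### Softness along a map, and lifting of sections. -/

namespace Sh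

variable {X Y W Z : TopCat.{u}} {T : Type*} [TopologicalSpace T]

/-- The functor sending an open subset `U` to the sheaf `ℤ_U` which represents the sections
over `U`. -/
noncomputable def freeOpen (Y : TopCat.{u}) :
    Opens Y ⥤ CategoryTheory.Sheaf (Opens.grothendieckTopology Y) AddCommGrpCat.{u} :=
  yoneda ⋙ (Functor.whiskeringRight _ _ _).obj AddCommGrpCat.free.{u} ⋙
    presheafToSheaf (Opens.grothendieckTopology Y) AddCommGrpCat.{u}

/-- Morphisms from `ℤ_U` to a sheaf are the sections of this sheaf over `U`. -/
noncomputable def freeOpenHomEquiv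
    (F : CategoryTheory.Sheaf (Opens.grothendieckTopology Y) AddCommGrpCat.{u}) (U : Opens Y) :
    ((freeOpen Y).obj U ⟶ F) ≃ F.obj.obj (op U) :=
  ((sheafificationAdjunction (Opens.grothendieckTopology Y) AddCommGrpCat.{u}).homEquiv _ F).trans
    (((AddCommGrpCat.adj.{u}.whiskerRight (Opens Y)ᵒᵖ).homEquiv (yoneda.obj U) F.obj).trans
      yonedaEquiv)

lemma freeOpenHomEquiv_naturality
    (F : CategoryTheory.Sheaf (Opens.grothendieckTopology Y) AddCommGrpCat.{u})
    {U V : Opens Y} (i : V ⟶ U) (a : (freeOpen Y).obj U ⟶ F) :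
    freeOpenHomEquiv F V ((freeOpen Y).map i ≫ a) = F.obj.map i.op (freeOpenHomEquiv F U a) := by
  have h1 := (sheafificationAdjunction (Opens.grothendieckTopology Y)
    AddCommGrpCat.{u}).homEquiv_naturality_left
      (((Functor.whiskeringRight _ _ _).obj AddCommGrpCat.free.{u}).map (yoneda.map i)) a
  have h2 := (AddCommGrpCat.adj.{u}.whiskerRight (Opens Y)ᵒᵖ).homEquiv_naturality_left
    (yoneda.map i) ((sheafificationAdjunction (Opens.grothendieckTopology Y)
      AddCommGrpCat.{u}).homEquiv _ F a)
  exact (congrArg _ (congrArg _ h1)).trans ((congrArg _ h2).trans (yonedaEquiv_naturality _ i).symm)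

/-- The free abelian group functor and sheafification both preserve monomorphisms. -/
lemma mono_freeOpen_map {U V : Opens Y} (i : V ⟶ U) : Mono ((freeOpen Y).map i) := by
  have : ∀ T, Mono ((((Functor.whiskeringRight _ _ _).obj AddCommGrpCat.free.{u}).map
      (yoneda.map i)).app T) := fun T =>
    inferInstanceAs (Mono (AddCommGrpCat.free.{u}.map ((yoneda.map i).app T)))
  have := NatTrans.mono_of_mono_app (((Functor.whiskeringRight _ _ _).obj
    AddCommGrpCat.free.{u}).map (yoneda.map i))
  exact inferInstanceAs (Mono ((presheafToSheaf (Opens.grothendieckTopology Y)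
    AddCommGrpCat.{u}).map (((Functor.whiskeringRight _ _ _).obj
    AddCommGrpCat.free.{u}).map (yoneda.map i))))

/-- Injective sheaves are flasque: the map `ℤ_V ⟶ I` given by `σ` extends along the monomorphism
`ℤ_V ⟶ ℤ_U`. -/
lemma exists_map_eq_of_injective (I : Sh Y) [hI : Injective I] {U V : Opens Y} (i : V ⟶ U)
    (σ : I.presheaf.obj (op V)) : ∃ τ : I.presheaf.obj (op U), I.presheaf.map i.op τ = σ := by
  obtain ⟨b, hb⟩ := @Injective.factors _ _ I hI _ _ ((freeOpenHomEquiv I V).symm σ)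
    ((freeOpen Y).map i) (mono_freeOpen_map i)
  refine ⟨freeOpenHomEquiv I U b, (freeOpenHomEquiv_naturality I i b).symm.trans ?_⟩
  exact (congrArg _ hb).trans (Equiv.apply_symm_apply _ _)

/-- A sheaf is soft along `φ` if its sections on compact subsets along `φ` extend. -/
def IsSoftAlong (F : Sh Y) (φ : T → Y) : Prop :=
  ∀ (K : Set T) (s : ∀ t, F.presheaf.stalk (φ t)), IsCompact K → F.ContSection φ s K →
    ∃ s' : ∀ t, F.presheaf.stalk (φ t), F.ContSection φ s' Set.univ ∧ ∀ t ∈ K, s' t = s t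

/-- A section on a compact set extends to an open subset of `Y`, then to all of `Y` by flasqueness,
and is pulled back along `φ`. -/
lemma isSoftAlong_of_injective (I : Sh Y) [Injective I] {φ : T → Y} (hφ : Continuous φ)
    (hd : ∀ t t', t ≠ t' → Disjoint (𝓝 (φ t)) (𝓝 (φ t'))) [LocallyCompactSpace T] :
    I.IsSoftAlong φ := by
  intro K s hK hs
  obtain ⟨O, r, hr, hrs⟩ := hs.exists_extension hφ hd hK
  obtain ⟨σ, hσ⟩ := hr.exists_germ_eq
  obtain ⟨τ, hτ⟩ := exists_map_eq_of_injective I (homOfLE le_top : O ⟶ ⊤) σ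
  refine ⟨fun t => I.presheaf.germ ⊤ (φ t) trivial τ,
    I.contSection_germ τ hφ.continuousOn fun t _ => ⟨trivial, rfl⟩, fun t ht => ?_⟩
  obtain ⟨h1, h2⟩ := hrs t ht
  rw [← h2, ← hσ _ h1, ← hτ]
  exact (I.presheaf.germ_res_apply _ _ _ _).symm

/-- Softness only involves sections along the map, and these are the same for `q^(*) F` along `ψ` as
for `F` along `q ∘ ψ`. -/
lemma IsSoftAlong.inverseImage {F : Sh Y} {q : W ⟶ Y} {ψ : T → W} (hψ : Continuous ψ)
    (h : F.IsSoftAlong fun t => q (ψ t)) : ((inverseImage q).obj F).IsSoftAlong ψ := by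
  intro K s hK hs
  choose r hr using fun t => (stalkPull_bijective q F (ψ t)).2 (s t)
  obtain ⟨r', hr', e⟩ := h K r hK ((contSection_stalkPull_iff q F hψ.continuousOn r).1
    (hs.congr fun t _ => hr t))
  exact ⟨fun t => stalkPull q F (ψ t) (r' t),
    (contSection_stalkPull_iff q F hψ.continuousOn r').2 hr',
    fun t ht => (congrArg _ (e t ht)).trans (hr t)⟩

/-- The map induced on stalks by a morphism of sheaves. -/
noncomputable abbrev stalkMap {F G : Sh Y} (a : F ⟶ G) (y : Y) :
    F.presheaf.stalk y ⟶ G.presheaf.stalk y :=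
  (TopCat.Presheaf.stalkFunctor AddCommGrpCat.{u} y).map a.hom

lemma stalkMap_germ {F G : Sh Y} (a : F ⟶ G) {U : Opens Y} {y : Y} (hy : y ∈ U)
    (σ : F.presheaf.obj (op U)) :
    stalkMap a y (F.presheaf.germ U y hy σ) = G.presheaf.germ U y hy (a.hom.app (op U) σ) :=
  TopCat.Presheaf.stalkFunctor_map_germ_apply U y hy a.hom σ

lemma stalk_shortExact {S : ShortComplex (Sh Y)} (hS : S.ShortExact) (y : Y) :
    (S.map (TopCat.Sheaf.forget AddCommGrpCat.{u} Y ⋙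
      TopCat.Presheaf.stalkFunctor AddCommGrpCat.{u} y)).ShortExact :=
  hS.map_of_exact _

lemma stalkMap_injective {S : ShortComplex (Sh Y)} (hS : S.ShortExact) (y : Y) :
    Function.Injective (stalkMap S.f y) :=
  (stalk_shortExact hS y).ab_injective_f

lemma stalkMap_surjective {S : ShortComplex (Sh Y)} (hS : S.ShortExact) (y : Y) :
    Function.Surjective (stalkMap S.g y) :=
  (stalk_shortExact hS y).ab_surjective_g

lemma exists_stalkMap_eq {S : ShortComplex (Sh Y)} (hS : S.ShortExact) {y : Y}
    {b : S.X₂.presheaf.stalk y} (hb : stalkMap S.g y b = 0) : ∃ a, stalkMap S.f y a = b :=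
  (ShortComplex.ab_exact_iff _).1 (stalk_shortExact hS y).exact b hb

lemma stalkMap_comp_eq_zero (S : ShortComplex (Sh Y)) (y : Y) (a : S.X₁.presheaf.stalk y) :
    stalkMap S.g y (stalkMap S.f y a) = 0 :=
  (S.map (TopCat.Sheaf.forget AddCommGrpCat.{u} Y ⋙
      TopCat.Presheaf.stalkFunctor AddCommGrpCat.{u} y)).ab_zero_apply a

/-- The continuity of a section may be checked after applying a monomorphism. -/
lemma ContSection.of_map {F G : Sh Y} (a : F ⟶ G) (ha : ∀ y, Function.Injective (stalkMap a y))
    {φ : T → Y} {s : ∀ t, F.presheaf.stalk (φ t)} {K : Set T}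
    (h : G.ContSection φ (fun t => stalkMap a (φ t) (s t)) K) : F.ContSection φ s K := by
  intro t ht
  obtain ⟨V, hV, σ, hσ⟩ := F.presheaf.exists_germ_eq (s t)
  refine F.continuousWithinAt_etaleSpace (h.continuousOn t ht) hV σ hσ.symm ?_
  obtain ⟨r, -, hr⟩ := F.exists_contSection_of_germ σ
  have hK : K ∩ φ ⁻¹' V ∈ 𝓝[K] t := inter_mem self_mem_nhdsWithin
    ((h.continuousOn t ht).preimage_mem_nhdsWithin (V.isOpen.mem_nhds hV))
  have hrc : G.ContSection φ (fun t => stalkMap a (φ t) (r (φ t))) (K ∩ φ ⁻¹' V) :=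
    ContSection.map a (F.contSection_germ σ (h.continuousOn.mono Set.inter_subset_left)
      fun t' ht' => ⟨ht'.2, hr _ ht'.2⟩)
  have hev := (h.mono Set.inter_subset_left).eventually_eq hrc ⟨ht, hV⟩
    (congrArg _ (hσ.symm.trans (hr _ hV).symm))
  rw [nhdsWithin_inter_of_mem' (mem_of_superset hK Set.inter_subset_right)] at hev
  filter_upwards [hev] with t' ht' hV'
  exact (ha _ ht').trans (hr _ hV')

section ShortExact

variable {S : ShortComplex (Sh Y)} (hS : S.ShortExact) {φ : T → Y}

include hS

/-- Lifts are chosen germ by germ; continuity is automatic because `S.f` is injective on stalks. -/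
lemma exists_contSection_of_map_eq_zero {K : Set T} {b : ∀ t, S.X₂.presheaf.stalk (φ t)}
    (hb : S.X₂.ContSection φ b K) (h0 : ∀ t ∈ K, stalkMap S.g (φ t) (b t) = 0) :
    ∃ a : ∀ t, S.X₁.presheaf.stalk (φ t), S.X₁.ContSection φ a K ∧
      ∀ t ∈ K, stalkMap S.f (φ t) (a t) = b t := by
  choose! a ha using fun t (h : stalkMap S.g (φ t) (b t) = 0) => exists_stalkMap_eq hS h
  exact ⟨a, ContSection.of_map S.f (stalkMap_injective hS)
    (hb.congr fun t ht => ha t (h0 t ht)), fun t ht => ha t (h0 t ht)⟩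

/-- If the kernel is soft, sections on compact subsets lift along an epimorphism. -/
lemma exists_contSection_lift [T2Space T] [LocallyCompactSpace T] (hA : S.X₁.IsSoftAlong φ)
    {K : Set T} (hK : IsCompact K) {c : ∀ t, S.X₃.presheaf.stalk (φ t)}
    (hc : S.X₃.ContSection φ c K) :
    ∃ b : ∀ t, S.X₂.presheaf.stalk (φ t), S.X₂.ContSection φ b K ∧
      ∀ t ∈ K, stalkMap S.g (φ t) (b t) = c t := by
  classical
  suffices ∃ C : Set T, IsCompact C ∧ K ∩ K ⊆ C ∧ C ⊆ K ∧
      ∃ b : ∀ t, S.X₂.presheaf.stalk (φ t), S.X₂.ContSection φ b C ∧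
        ∀ t ∈ C, stalkMap S.g (φ t) (b t) = c t by
    obtain ⟨C, -, hKC, -, b, hb, e⟩ := this
    rw [Set.inter_self] at hKC
    exact ⟨b, hb.mono hKC, fun t ht => e t (hKC ht)⟩
  refine hK.induction_on (p := fun R => ∃ C : Set T, IsCompact C ∧ R ∩ K ⊆ C ∧ C ⊆ K ∧
      ∃ b : ∀ t, S.X₂.presheaf.stalk (φ t), S.X₂.ContSection φ b C ∧
        ∀ t ∈ C, stalkMap S.g (φ t) (b t) = c t) ?_ ?_ ?_ ?_
  · exact ⟨∅, isCompact_empty, by simp, by simp, fun _ => 0,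
      S.X₂.contSection_zero (continuousOn_empty _), by simp⟩
  · rintro R R' hR ⟨C, hC, hRC, h'⟩
    exact ⟨C, hC, (Set.inter_subset_inter_left _ hR).trans hRC, h'⟩
  · rintro R R' ⟨C, hC, hRC, hCK, b, hb, e⟩ ⟨C', hC', hRC', hCK', b', hb', e'⟩
    -- On `C ∩ C'` the two lifts differ by a section of the kernel. Softness extends it, and adding
    -- it to `b'` makes the lifts agree there.
    obtain ⟨a, ha, hab⟩ := exists_contSection_of_map_eq_zero hS
      ((hb.mono (Set.inter_subset_left (t := C'))).sub (hb'.mono Set.inter_subset_right))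
      (fun t ht => by rw [map_sub, e t ht.1, e' t ht.2, sub_self])
    obtain ⟨a', ha', haa'⟩ := hA _ a (hC.inter hC') ha
    let d : ∀ t, S.X₂.presheaf.stalk (φ t) :=
      fun t => if t ∈ C then b t else b' t + stalkMap S.f (φ t) (a' t)
    have hd : ∀ t ∈ C, d t = b t := fun t ht => if_pos ht
    have hd' : ∀ t ∈ C', d t = b' t + stalkMap S.f (φ t) (a' t) := fun t ht => by
      by_cases htC : t ∈ C
      · rw [hd t htC, haa' t ⟨htC, ht⟩, hab t ⟨htC, ht⟩, add_sub_cancel]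
      · exact if_neg htC
    refine ⟨C ∪ C', hC.union hC', ?_, Set.union_subset hCK hCK', d, ?_, ?_⟩
    · rw [Set.union_inter_distrib_right]
      exact Set.union_subset_union hRC hRC'
    · exact (hb.congr hd).union_of_isClosed ((hb'.add (ContSection.map S.f
        (ha'.mono (Set.subset_univ _)))).congr hd') hC.isClosed hC'.isClosed
    · rintro t (ht | ht)
      · rw [hd t ht, e t ht]
      · rw [hd' t ht, map_add, e' t ht, stalkMap_comp_eq_zero, add_zero]
  · intro t ht
    -- A lift of the germ at `t` spreads out to a section, whose image agrees with `c` near `t`.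
    obtain ⟨b₀, hb₀⟩ := stalkMap_surjective hS (φ t) (c t)
    obtain ⟨V, hV, β, rfl⟩ := S.X₂.presheaf.exists_germ_eq b₀
    obtain ⟨r, -, hr⟩ := S.X₂.exists_contSection_of_germ β
    have hrc : S.X₂.ContSection φ (fun t => r (φ t)) (K ∩ φ ⁻¹' V) :=
      S.X₂.contSection_germ β (hc.continuousOn.mono Set.inter_subset_left)
        fun t' ht' => ⟨ht'.2, hr _ ht'.2⟩
    have hev := (ContSection.map S.g hrc).eventually_eq (hc.mono Set.inter_subset_left) ⟨ht, hV⟩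
      ((congrArg _ (hr _ hV)).trans hb₀)
    have hVK : φ ⁻¹' V ∈ 𝓝[K] t :=
      (hc.continuousOn t ht).preimage_mem_nhdsWithin (V.isOpen.mem_nhds hV)
    rw [nhdsWithin_inter_of_mem' hVK] at hev
    obtain ⟨N, hN, hNK⟩ := mem_nhdsWithin_iff_exists_mem_nhds_inter.1 (inter_mem hev hVK)
    obtain ⟨C, hC, hCN, hCc⟩ := LocallyCompactSpace.local_compact_nhds t N hN
    refine ⟨C, mem_nhdsWithin_of_mem_nhds hC, C ∩ K, hCc.inter_right hK.isClosed, subset_rfl,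
      Set.inter_subset_right, fun t => r (φ t), hrc.mono fun t' ht' => ?_, fun t' ht' => ?_⟩
    · exact ⟨ht'.2, (hNK ⟨hCN ht'.1, ht'.2⟩).2⟩
    · exact (hNK ⟨hCN ht'.1, ht'.2⟩).1

/-- Softness of the kernel lifts a section on `K` to the middle term, whose softness extends the
lift. -/
lemma IsSoftAlong.of_shortExact [T2Space T] [LocallyCompactSpace T] (hA : S.X₁.IsSoftAlong φ)
    (hB : S.X₂.IsSoftAlong φ) : S.X₃.IsSoftAlong φ := by
  intro K c hK hc
  obtain ⟨b, hb, hbc⟩ := exists_contSection_lift hS hA hK hc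
  obtain ⟨b', hb', e⟩ := hB K b hK hb
  exact ⟨_, ContSection.map S.g hb', fun t ht => (congrArg _ (e t ht)).trans (hbc t ht)⟩

/-- If the kernel is soft, sections with compact support lift along an epimorphism. -/
lemma exists_contSection_lift_of_compact_support [T2Space T] [LocallyCompactSpace T]
    (hφ : Continuous φ) (hA : S.X₁.IsSoftAlong φ)
    {K : Set T} (hK : IsCompact K) {c : ∀ t, S.X₃.presheaf.stalk (φ t)}
    (hc : S.X₃.ContSection φ c Set.univ) (hcK : ∀ t ∉ K, c t = 0) :
    ∃ b : ∀ t, S.X₂.presheaf.stalk (φ t), S.X₂.ContSection φ b Set.univ ∧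
      (∀ t, stalkMap S.g (φ t) (b t) = c t) ∧
      ∃ L : Set T, IsCompact L ∧ ∀ t ∉ L, b t = 0 := by
  classical
  -- `L` is a compact neighbourhood of `K`. On its frontier `c` is zero, so a lift over `L` is there
  -- a section of the kernel; subtracting an extension of that section makes the lift vanish on the
  -- frontier, and extension by zero is continuous.
  obtain ⟨L, hL, hKL⟩ := exists_compact_superset hK
  obtain ⟨b, hb, hbc⟩ := exists_contSection_lift hS hA hL (hc.mono (Set.subset_univ _))
  have hfr : frontier L ⊆ L := hL.isClosed.frontier_subset
  obtain ⟨a, ha, hab⟩ := exists_contSection_of_map_eq_zero hS (hb.mono hfr) (fun t ht => by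
    rw [hbc t (hfr ht), hcK t fun h => ht.2 (hKL h)])
  obtain ⟨a', ha', haa'⟩ := hA _ a (hL.of_isClosed_subset isClosed_frontier hfr) ha
  let d : ∀ t, S.X₂.presheaf.stalk (φ t) :=
    fun t => if t ∈ L then b t - stalkMap S.f (φ t) (a' t) else 0
  have hd : ∀ t ∈ L, d t = b t - stalkMap S.f (φ t) (a' t) := fun t ht => if_pos ht
  have hd0 : ∀ t ∈ (interior L)ᶜ, d t = 0 := fun t ht => by
    by_cases htL : t ∈ L
    · have : t ∈ frontier L := ⟨subset_closure htL, ht⟩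
      rw [hd t htL, haa' t this, hab t this, sub_self]
    · exact if_neg htL
  refine ⟨d, ?_, fun t => ?_, L, hL, fun t ht => if_neg ht⟩
  · refine (((hb.sub (ContSection.map S.f (ha'.mono (Set.subset_univ _)))).congr
      hd).union_of_isClosed ((S.X₂.contSection_zero hφ.continuousOn).congr hd0) hL.isClosed
      isOpen_interior.isClosed_compl).mono fun t _ => ?_
    by_cases ht : t ∈ interior L
    · exact Or.inl (interior_subset ht)
    · exact Or.inr ht
  · by_cases ht : t ∈ L
    · rw [hd t ht, map_sub, hbc t ht, stalkMap_comp_eq_zero, sub_zero]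
    · rw [hcK t fun h => ht (interior_subset (hKL h)), show d t = 0 from if_neg ht, map_zero]

end ShortExact

end Sh

/-! ### Exactness of the inverse image and, on fibrewise soft kernels, of the proper direct image.
-/

namespace Sh

variable {X Y W Z : TopCat.{u}} {T : Type*} [TopologicalSpace T]

lemma stalkMap_comp {F G H : Sh Y} (a : F ⟶ G) (b : G ⟶ H) (y : Y) (s : F.presheaf.stalk y) :
    stalkMap (a ≫ b) y s = stalkMap b y (stalkMap a y s) :=
  ConcreteCategory.congr_hom
    ((TopCat.Presheaf.stalkFunctor AddCommGrpCat.{u} y).map_comp a.hom b.hom) s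

lemma stalkMap_add {F G : Sh Y} (a b : F ⟶ G) (y : Y) (s : F.presheaf.stalk y) :
    stalkMap (a + b) y s = stalkMap a y s + stalkMap b y s := by
  obtain ⟨U, hU, σ, rfl⟩ := F.presheaf.exists_germ_eq s
  refine (stalkMap_germ _ hU σ).trans ?_
  rw [stalkMap_germ, stalkMap_germ, ← map_add]
  rfl

lemma stalkMap_id (F : Sh Y) (y : Y) (s : F.presheaf.stalk y) :
    stalkMap (𝟙 F) y s = s :=
  ConcreteCategory.congr_hom
    ((TopCat.Presheaf.stalkFunctor AddCommGrpCat.{u} y).map_id F.presheaf) s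

lemma IsSoftAlong.biprod {F G : Sh Y} {φ : T → Y} (hF : F.IsSoftAlong φ) (hG : G.IsSoftAlong φ) :
    (F ⊞ G).IsSoftAlong φ := by
  intro K s hK hs
  obtain ⟨a, ha, ha'⟩ := hF K _ hK (ContSection.map (biprod.fst : F ⊞ G ⟶ F) hs)
  obtain ⟨b, hb, hb'⟩ := hG K _ hK (ContSection.map (biprod.snd : F ⊞ G ⟶ G) hs)
  refine ⟨_, (ContSection.map (biprod.inl : F ⟶ F ⊞ G) ha).add (ContSection.map (biprod.inr : G ⟶ F ⊞ G) hb), fun t ht => ?_⟩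
  rw [ha' t ht, hb' t ht]
  refine (congrArg₂ _ (stalkMap_comp _ _ _ _).symm (stalkMap_comp _ _ _ _).symm).trans ?_
  rw [← stalkMap_add, biprod.total, stalkMap_id]

/-- The sheaves which are soft on all the fibers of a map. -/
def IsSoftOnFibers (g : W ⟶ Z) : ObjectProperty (Sh W) :=
  fun F => ∀ z : Z, F.IsSoftAlong fun t : g ⁻¹' {z} => t.1

section

variable {f : Y ⟶ X} {q : W ⟶ Y} {p : Z ⟶ X} {g : W ⟶ Z}

lemma isSoftOnFibers_of_injective (hg : IsSeparatedMap g) (hg' : IsLocallyProper g) (I : Sh W)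
    [Injective I] : IsSoftOnFibers g I := fun z => by
  have := hg'.locallyCompactSpace_fiber z
  refine isSoftAlong_of_injective I continuous_subtype_val fun t t' h => ?_
  exact hg.disjoint_nhds (t.2.trans t'.2.symm) (Subtype.coe_injective.ne h)

/-- The fibre of `g` embeds by `q` as a fibre of `f`, so separatedness of `f` makes `I` itself soft
along it. -/
lemma isSoftOnFibers_inverseImage_of_injective (sq : IsPullback q g f p) (hf : IsSeparatedMap f)
    (hg' : IsLocallyProper g) (I : Sh Y) [Injective I] :
    IsSoftOnFibers g ((inverseImage q).obj I) := fun z => by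
  have := hg'.locallyCompactSpace_fiber z
  refine IsSoftAlong.inverseImage continuous_subtype_val
    (isSoftAlong_of_injective I (isEmbedding_fiber sq z).continuous fun t t' h => ?_)
  have hr := fun t => (range_fiber sq z).subset (Set.mem_range_self t)
  exact hf.disjoint_nhds ((hr t).trans (hr t').symm) ((isEmbedding_fiber sq z).injective.ne h)

lemma isSoftOnFibers_of_shortExact (hg : IsSeparatedMap g) (hg' : IsLocallyProper g)
    {S : ShortComplex (Sh W)} (hS : S.ShortExact) (h₁ : IsSoftOnFibers g S.X₁)
    (h₂ : IsSoftOnFibers g S.X₂) : IsSoftOnFibers g S.X₃ := fun z => by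
  have := hg'.locallyCompactSpace_fiber z
  have := hg.t2Space_fiber z
  exact IsSoftAlong.of_shortExact hS (h₁ z) (h₂ z)

lemma isSoftOnFibers_biprod {F G : Sh W} (hF : IsSoftOnFibers g F) (hG : IsSoftOnFibers g G) :
    IsSoftOnFibers g (F ⊞ G) := fun z => (hF z).biprod (hG z)

/-- A complex of sheaves is a short exact sequence if it is so on the stalks. -/
lemma shortExact_of_stalkMap (S : ShortComplex (Sh Y))
    (h₁ : ∀ y, Function.Injective (stalkMap S.f y))
    (h₂ : ∀ y (b : S.X₂.presheaf.stalk y), stalkMap S.g y b = 0 → ∃ a, stalkMap S.f y a = b)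
    (h₃ : ∀ y, Function.Surjective (stalkMap S.g y)) : S.ShortExact where
  exact := by
    rw [TopCat.Sheaf.exact_iff_stalkFunctor_map_exact]
    intro y
    exact (ShortComplex.ab_exact_iff _).2 (h₂ y)
  mono_f := by
    rw [TopCat.Presheaf.mono_iff_stalk_mono]
    exact fun y => (AddCommGrpCat.mono_iff_injective _).2 (h₁ y)
  epi_g := by
    rw [← TopCat.Sheaf.isLocallySurjective_iff_epi,
      TopCat.Presheaf.locally_surjective_iff_surjective_on_stalks]
    exact h₃

lemma stalkPull_naturality (q : W ⟶ Y) {F G : Sh Y} (a : F ⟶ G) (w : W)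
    (s : F.presheaf.stalk (q w)) :
    stalkMap ((inverseImage q).map a) w (stalkPull q F w s) =
      stalkPull q G w (stalkMap a (q w) s) := by
  obtain ⟨U, hU, σ, rfl⟩ := F.presheaf.exists_germ_eq s
  rw [stalkMap_germ, ← germ_pullSection q F w hU, ← germ_pullSection q G w hU]
  refine (stalkMap_germ ((inverseImage q).map a) (U := (Opens.map q).obj U) hU _).trans ?_
  have h := congrArg (fun b => b.hom.app (op U))
    ((TopCat.Sheaf.pullbackPushforwardAdjunction AddCommGrpCat.{u} q).unit.naturality a)
  exact congrArg _ (ConcreteCategory.congr_hom h σ).symm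

/-- Exactness is a matter of stalks, and those of `q^(*) F` are stalks of `F`, naturally in `F`. -/
lemma inverseImage_map_shortExact (q : W ⟶ Y) {S : ShortComplex (Sh Y)} (hS : S.ShortExact) :
    (S.map (inverseImage q)).ShortExact := by
  refine shortExact_of_stalkMap _ (fun w => ?_) (fun w b hb => ?_) (fun w c => ?_)
  · refine (injective_iff_map_eq_zero (stalkMap _ w).hom).2 fun a ha => ?_
    obtain ⟨a, rfl⟩ := (stalkPull_bijective q S.X₁ w).2 a
    have h := (stalkPull_naturality q S.f w a).symm.trans ha
    have h := (stalkPull_bijective q S.X₂ w).1 (h.trans (map_zero _).symm)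
    have h := stalkMap_injective hS (q w) (h.trans (map_zero _).symm)
    exact (congrArg _ h).trans (map_zero _)
  · obtain ⟨b, rfl⟩ := (stalkPull_bijective q S.X₂ w).2 b
    have h := (stalkPull_naturality q S.g w b).symm.trans hb
    have h := (stalkPull_bijective q S.X₃ w).1 (h.trans (map_zero _).symm)
    obtain ⟨a, rfl⟩ := exists_stalkMap_eq hS h
    exact ⟨_, stalkPull_naturality q S.f w a⟩
  · obtain ⟨c, rfl⟩ := (stalkPull_bijective q S.X₃ w).2 c
    obtain ⟨b, rfl⟩ := stalkMap_surjective hS (q w) c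
    exact ⟨_, stalkPull_naturality q S.g w b⟩

/-- The proper direct image of a short exact sequence whose kernel is soft on the fibers. -/
lemma properDirectImage_map_shortExact (hg : IsSeparatedMap g) (hg' : IsLocallyProper g)
    {S : ShortComplex (Sh W)} (hS : S.ShortExact) (h₁ : IsSoftOnFibers g S.X₁) :
    (S.map (properDirectImage g)).ShortExact := by
  have hmem : ∀ {z : Z} {U : Opens Z} (_ : z ∈ U) (t : g ⁻¹' {z}), g t.1 ∈ U := fun {z U} hz t => by
    rwa [show g t.1 = z from t.2]
  refine shortExact_of_stalkMap _ (fun z => ?_) (fun z b hb => ?_) (fun z c => ?_)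
  · refine (injective_iff_map_eq_zero (stalkMap _ z).hom).2 fun a ha => ?_
    obtain ⟨U, hU, σ, rfl⟩ := ((properDirectImage g).obj S.X₁).presheaf.exists_germ_eq a
    have h := germ_eq_zero_of_germ_properDirectImage g S.X₂ hU
      (((properDirectImage g).map S.f).hom.app (op U) σ)
      ((stalkMap_germ ((properDirectImage g).map S.f) hU σ).symm.trans ha)
    refine germ_properDirectImage_eq_zero g S.X₁ hU σ fun w hw hwz => ?_
    apply stalkMap_injective hS w
    rw [map_zero]
    exact (stalkMap_germ S.f (U := (Opens.map g).obj U) hw σ.1).trans (h w hw hwz)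
  · obtain ⟨U, hU, σ, rfl⟩ := ((properDirectImage g).obj S.X₂).presheaf.exists_germ_eq b
    have h := germ_eq_zero_of_germ_properDirectImage g S.X₃ hU
      (((properDirectImage g).map S.g).hom.app (op U) σ)
      ((stalkMap_germ ((properDirectImage g).map S.g) hU σ).symm.trans hb)
    obtain ⟨hc, K, hK, hcK⟩ := exists_fiber_of_properSections g S.X₂ hU σ.2
      (s := fun t => S.X₂.presheaf.germ ((Opens.map g).obj U) t.1 (hmem hU t) σ.1)
      (fun t ht => rfl)
    -- The lift to the kernel keeps compact support because `S.f` is injective on stalks; softness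
    -- plays no role in this step.
    obtain ⟨a, ha, hab⟩ := exists_contSection_of_map_eq_zero hS hc (fun t _ =>
      (stalkMap_germ S.g (U := (Opens.map g).obj U) (hmem hU t) σ.1).trans (h t.1 (hmem hU t) t.2))
    have := hg'.locallyCompactSpace_fiber z
    obtain ⟨V, hV, τ, hτ, e⟩ := exists_properSections_of_fiber hg hg' S.X₁
      (φ := fun t : g ⁻¹' {z} => t.1) IsEmbedding.subtypeVal Subtype.range_val ha hK (fun t ht => by
        apply stalkMap_injective hS t.1
        rw [map_zero, hab t trivial, hcK t ht])
    refine ⟨((properDirectImage g).obj S.X₁).presheaf.germ V z hV ⟨τ, hτ⟩, ?_⟩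
    refine (stalkMap_germ ((properDirectImage g).map S.f) hV ⟨τ, hτ⟩).trans ?_
    refine germ_properDirectImage_eq g S.X₂ hV hU _ σ fun w hwV hwU hwz => ?_
    refine (stalkMap_germ S.f (U := (Opens.map g).obj V) hwV τ).symm.trans ?_
    exact (congrArg _ (e ⟨w, hwz⟩ hwV)).trans (hab ⟨w, hwz⟩ trivial)
  · obtain ⟨U, hU, σ, rfl⟩ := ((properDirectImage g).obj S.X₃).presheaf.exists_germ_eq c
    obtain ⟨hc, K, hK, hcK⟩ := exists_fiber_of_properSections g S.X₃ hU σ.2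
      (s := fun t => S.X₃.presheaf.germ ((Opens.map g).obj U) t.1 (hmem hU t) σ.1)
      (fun t ht => rfl)
    have := hg'.locallyCompactSpace_fiber z
    have := hg.t2Space_fiber z
    -- Only surjectivity on stalks needs the kernel to be soft.
    obtain ⟨b, hb, hbc, L, hL, hbL⟩ := exists_contSection_lift_of_compact_support hS
      continuous_subtype_val (h₁ z) hK hc hcK
    obtain ⟨V, hV, τ, hτ, e⟩ := exists_properSections_of_fiber hg hg' S.X₂
      (φ := fun t : g ⁻¹' {z} => t.1) IsEmbedding.subtypeVal Subtype.range_val hb hL hbL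
    refine ⟨((properDirectImage g).obj S.X₂).presheaf.germ V z hV ⟨τ, hτ⟩, ?_⟩
    refine (stalkMap_germ ((properDirectImage g).map S.g) hV ⟨τ, hτ⟩).trans ?_
    refine germ_properDirectImage_eq g S.X₃ hV hU _ σ fun w hwV hwU hwz => ?_
    refine (stalkMap_germ S.g (U := (Opens.map g).obj V) hwV τ).symm.trans ?_
    exact (congrArg _ (e ⟨w, hwz⟩ hwV)).trans (hbc ⟨w, hwz⟩)

end

end Sh

/-! ### Classes of objects that compute a right derived functor. -/

namespace CategoryTheory

variable {C D : Type*} [Category* C] [Category* D] [Abelian C] [Abelian D]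

/-- A class of objects `P` is adapted to a functor `F` if it contains the injective objects, is
closed under binary biproducts and cokernels of monomorphisms, and if `F` is exact on the short
exact sequences whose first term is in `P`. -/
structure ObjectProperty.IsAdapted (P : ObjectProperty C) (F : C ⥤ D) [F.Additive] : Prop where
  of_injective (I : C) [Injective I] : P I
  biprod {A B : C} : P A → P B → P (A ⊞ B)
  of_shortExact {S : ShortComplex C} : S.ShortExact → P S.X₁ → P S.X₂ → P S.X₃
  map_shortExact {S : ShortComplex C} : S.ShortExact → P S.X₁ → (S.map F).ShortExact

end CategoryTheory

namespace HomologicalComplex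

variable {C : Type*} [Category* C] [Abelian C]

/-- The short complex `Zⁱ ⟶ Kⁱ ⟶ Zʲ` of a cochain complex. -/
noncomputable abbrev cyclesShortComplex (K : CochainComplex C ℤ) (i j : ℤ) : ShortComplex C :=
  ShortComplex.mk (K.iCycles i) (K.toCycles i j) (by
    rw [← cancel_mono (K.iCycles j), Category.assoc, toCycles_i, iCycles_d, zero_comp])

/-- The differential factors through the monomorphism `Zʲ ⟶ Kʲ`, so the kernel is still `Zⁱ`; the
map onto `Zʲ` is epi by exactness at `j`. -/
lemma Acyclic.cyclesShortComplex_shortExact {K : CochainComplex C ℤ} (hK : K.Acyclic) (i j : ℤ)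
    (hij : i + 1 = j) : (cyclesShortComplex K i j).ShortExact where
  exact := by
    apply ShortComplex.exact_of_f_is_kernel
    exact isKernelOfComp (K.iCycles j) _ (K.cyclesIsKernel i j (by simpa using hij)) _
      (K.toCycles_i i j)
  mono_f := inferInstanceAs (Mono (K.iCycles i))
  epi_g := by
    have h := (hK j).epi_toCycles
    obtain rfl : (ComplexShape.up ℤ).prev j = i := by simp [← hij]
    exact h

end HomologicalComplex

namespace CategoryTheory.ObjectProperty.IsAdapted

variable {C D : Type*} [Category* C] [Category* D] [Abelian C] [Abelian D] {P : ObjectProperty C} {F : C ⥤ D} [F.Additive]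
  (hP : P.IsAdapted F)

include hP

open ZeroObject

lemma of_isZero {A : C} (hA : IsZero A) : P A :=
  have := hA.injective
  hP.of_injective A

/-- Closure under isomorphisms is not part of `IsAdapted`; it follows from closure under cokernels,
applied to `0 ⟶ A ≅ B`. -/
lemma of_iso {A B : C} (e : A ≅ B) (hA : P A) : P B := by
  let S : ShortComplex C := ShortComplex.mk (0 : (0 : C) ⟶ A) e.hom zero_comp
  have hS : S.ShortExact :=
    { exact := by
        rw [S.exact_iff_mono rfl]
        exact inferInstanceAs (Mono e.hom)
      mono_f := inferInstanceAs (Mono (0 : (0 : C) ⟶ A))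
      epi_g := inferInstanceAs (Epi e.hom) }
  exact hP.of_shortExact hS (hP.of_isZero (isZero_zero C)) hA

/-- Cycles vanish below the bound `n₀`, and each next cycle object is the cokernel of `Zⁿ ⟶ Kⁿ`; the
induction starts in degree `n₀ - 1`. -/
lemma cycles {K : CochainComplex C ℤ} (hK : K.Acyclic) (hKP : ∀ n, P (K.X n)) (n₀ : ℤ)
    [K.IsStrictlyGE n₀] (n : ℤ) : P (K.cycles n) := by
  have h₀ : ∀ n < n₀, P (K.cycles n) := fun n hn => hP.of_isZero
    (IsZero.of_mono (K.iCycles n) (K.isZero_of_isStrictlyGE n₀ n hn))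
  have h : ∀ m : ℕ, P (K.cycles (n₀ - 1 + m)) := fun m => by
    induction m with
    | zero => exact h₀ _ (by simp)
    | succ m ih =>
      have := hP.of_shortExact (hK.cyclesShortComplex_shortExact (n₀ - 1 + m) _ rfl) ih (hKP _)
      rw [Nat.cast_succ, ← add_assoc]
      exact this
  by_cases hn : n < n₀
  · exact h₀ n hn
  · obtain ⟨m, hm⟩ := Int.eq_ofNat_of_zero_le (a := n - (n₀ - 1)) (by lia)
    obtain rfl : n = n₀ - 1 + m := by lia
    exact h m

/-- The image of a bounded below acyclic complex with terms in an adapted class is acyclic. -/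
lemma map_acyclic {K : CochainComplex C ℤ} (hK : K.Acyclic) (hKP : ∀ n, P (K.X n)) (n₀ : ℤ)
    [K.IsStrictlyGE n₀] : ((F.mapHomologicalComplex _).obj K).Acyclic := by
  have hS : ∀ i j, i + 1 = j → ((HomologicalComplex.cyclesShortComplex K i j).map F).ShortExact :=
    fun i j hij => hP.map_shortExact (hK.cyclesShortComplex_shortExact i j hij)
      (hP.cycles hK hKP n₀ i)
  intro n
  rw [HomologicalComplex.exactAt_iff' _ (n - 1) n (n + 1) (by simp) (by simp)]
  -- `S` mediates between two sequences: `φ` replaces `F Kⁿ⁻¹` by its quotient `F Zⁿ`, and `ψ`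
  -- embeds `F Zⁿ⁺¹` into `F Kⁿ⁺¹`. Neither changes exactness in the middle.
  let S : ShortComplex D := ShortComplex.mk (F.map (K.iCycles n)) (F.map (K.d n (n + 1))) (by
    rw [← F.map_comp, K.iCycles_d, F.map_zero])
  let φ : ((F.mapHomologicalComplex _).obj K).sc' (n - 1) n (n + 1) ⟶ S :=
    { τ₁ := F.map (K.toCycles (n - 1) n)
      τ₂ := 𝟙 (F.obj (K.X n))
      τ₃ := 𝟙 (F.obj (K.X (n + 1)))
      comm₁₂ := ((F.map_comp _ _).symm.trans (congrArg F.map (K.toCycles_i (n - 1) n))).trans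
        (Category.comp_id _).symm
      comm₂₃ := (Category.id_comp _).trans (Category.comp_id _).symm }
  let ψ : (HomologicalComplex.cyclesShortComplex K n (n + 1)).map F ⟶ S :=
    { τ₁ := 𝟙 (F.obj (K.cycles n))
      τ₂ := 𝟙 (F.obj (K.X n))
      τ₃ := F.map (K.iCycles (n + 1))
      comm₁₂ := (Category.id_comp _).trans (Category.comp_id _).symm
      comm₂₃ := (Category.id_comp _).trans
        ((congrArg F.map (K.toCycles_i n (n + 1))).symm.trans (F.map_comp _ _)) }
  have : Epi φ.τ₁ := (hS (n - 1) n (by simp)).epi_g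
  have : IsIso φ.τ₂ := inferInstanceAs (IsIso (𝟙 _))
  have : Mono φ.τ₃ := inferInstanceAs (Mono (𝟙 _))
  have : Epi ψ.τ₁ := inferInstanceAs (Epi (𝟙 _))
  have : IsIso ψ.τ₂ := inferInstanceAs (IsIso (𝟙 _))
  have : Mono ψ.τ₃ := (hS (n + 1) (n + 1 + 1) rfl).mono_f
  rw [ShortComplex.exact_iff_of_epi_of_isIso_of_mono φ,
    ← ShortComplex.exact_iff_of_epi_of_isIso_of_mono ψ]
  exact (hS n (n + 1) rfl).exact

/-- The image of a quasi-isomorphism between bounded below complexes with terms in an adapted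
class is a quasi-isomorphism. -/
lemma map_quasiIso {K L : HomotopyCategory.Plus C} (hK : ∀ n, P (K.obj.as.X n))
    (hL : ∀ n, P (L.obj.as.X n)) (w : K ⟶ L) (hw : HomotopyCategory.Plus.quasiIso C w) :
    HomotopyCategory.Plus.quasiIso D (F.mapHomotopyCategoryPlus.map w) := by
  obtain ⟨n₁, _⟩ : CochainComplex.plus C K.obj.as :=
    (HomotopyCategory.plus_quotient_obj_iff _).1 K.property
  obtain ⟨n₂, _⟩ : CochainComplex.plus C L.obj.as :=
    (HomotopyCategory.plus_quotient_obj_iff _).1 L.property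
  obtain ⟨φ : K.obj.as ⟶ L.obj.as, hφ⟩ :=
    (HomotopyCategory.quotient C (.up ℤ)).map_surjective w.hom
  have hT := HomotopyCategory.mappingCone_triangleh_distinguished φ
  -- The statement is transferred to the cone: it is acyclic, its terms stay in `P`, and `F`
  -- preserves the distinguished triangle.
  have hM : (CochainComplex.mappingCone φ).Acyclic := by
    rw [← HomotopyCategory.quotient_obj_mem_subcategoryAcyclic_iff_acyclic]
    refine ((HomotopyCategory.subcategoryAcyclic C).trW_iff_of_distinguished _ hT).1 ?_
    rw [← HomotopyCategory.quasiIso_eq_trW_subcategoryAcyclic]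
    exact (congrArg (fun a : K.obj ⟶ L.obj => HomotopyCategory.quasiIso C (.up ℤ) a) hφ).mpr
      ((HomotopyCategory.Plus.quasiIso_iff C w).1 hw)
  have hMP : ∀ n, P ((CochainComplex.mappingCone φ).X n) := fun n =>
    hP.of_iso (HomologicalComplex.homotopyCofiber.XIsoBiprod φ n (n + 1) rfl).symm
      (hP.biprod (hK _) (hL _))
  -- In degree `n` the cone is the biproduct of `Kⁿ⁺¹` and `Lⁿ`, whence the shift by one in the
  -- first bound.
  have : (CochainComplex.mappingCone φ).IsStrictlyGE (min (n₁ - 1) n₂) :=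
    CochainComplex.isStrictlyGE_mappingCone φ n₁ n₂ _ (by simp) (by simp)
  have hFM := hP.map_acyclic hM hMP (min (n₁ - 1) n₂)
  rw [← HomotopyCategory.quotient_obj_mem_subcategoryAcyclic_iff_acyclic] at hFM
  have h := ((HomotopyCategory.subcategoryAcyclic D).trW_iff_of_distinguished _
    ((F.mapHomotopyCategory (.up ℤ)).map_distinguished _ hT)).2 hFM
  rw [← HomotopyCategory.quasiIso_eq_trW_subcategoryAcyclic] at h
  exact (congrArg (fun a : K.obj ⟶ L.obj => HomotopyCategory.quasiIso D (.up ℤ)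
    ((F.mapHomotopyCategory (.up ℤ)).map a)) hφ).mp h

/-- The right derived functor of `F` may be computed on complexes with terms in a class
adapted to `F`. -/
lemma isIso_rightDerivedFunctorPlusUnit_app [EnoughInjectives C] [HasDerivedCategory C]
    [HasDerivedCategory D] {K : HomotopyCategory.Plus C} (hK : ∀ n, P (K.obj.as.X n)) :
    IsIso (F.rightDerivedFunctorPlusUnit.app K) := by
  -- In the naturality square of the unit for an injective resolution of `K`, the other three maps
  -- become invertible: `F` of the resolution is a quasi-isomorphism because both sides have terms
  -- in `P`.
  let r : (HomotopyCategory.Plus.localizerMorphism C).RightResolution K := Classical.arbitrary _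
  have h₁ : IsIso (DerivedCategory.Plus.Qh.map r.w) :=
    Localization.inverts DerivedCategory.Plus.Qh (HomotopyCategory.Plus.quasiIso C) _ r.hw
  have hI : ∀ n, P (((InjectiveObject.ι C).mapHomotopyCategoryPlus.obj r.X₁).obj.as.X n) :=
    fun n => hP.of_injective _
  have h₂ : IsIso (DerivedCategory.Plus.Qh.map (F.mapHomotopyCategoryPlus.map r.w)) :=
    Localization.inverts DerivedCategory.Plus.Qh (HomotopyCategory.Plus.quasiIso D) _
      (hP.map_quasiIso hK hI r.w r.hw)
  have h := F.rightDerivedFunctorPlusUnit.naturality r.w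
  have h₃ : IsIso (F.rightDerivedFunctorPlusUnit.app
      ((InjectiveObject.ι C).mapHomotopyCategoryPlus.obj r.X₁)) := inferInstance
  have h₄ : IsIso ((F.mapHomotopyCategoryPlus ⋙ DerivedCategory.Plus.Qh).map r.w ≫
      F.rightDerivedFunctorPlusUnit.app
        ((HomotopyCategory.Plus.localizerMorphism C).functor.obj r.X₁)) :=
    @IsIso.comp_isIso _ _ _ _ _ _ _ h₂ h₃
  rw [h] at h₄
  have h₅ : IsIso ((DerivedCategory.Plus.Qh ⋙ F.rightDerivedFunctorPlus).map r.w) :=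
    inferInstanceAs (IsIso (F.rightDerivedFunctorPlus.map (DerivedCategory.Plus.Qh.map r.w)))
  exact IsIso.of_isIso_comp_right _ ((DerivedCategory.Plus.Qh ⋙ F.rightDerivedFunctorPlus).map r.w)

end CategoryTheory.ObjectProperty.IsAdapted

/-! ### Compatibility of the functorial constructions with the shift. -/

namespace CategoryTheory.Functor

section

variable {C D E : Type*} [Category* C] [Category* D] [Category* E]

/-- A faithful `i` detects the required equality. With `i` the inclusion of the bounded below
homotopy category, this reduces to unbounded complexes. -/
lemma natTrans_commShift_of_whiskerRight [HasShift C ℤ] [HasShift D ℤ] [HasShift E ℤ]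
    {F G : C ⥤ D} [F.CommShift ℤ] [G.CommShift ℤ] (τ : F ⟶ G) (i : D ⥤ E) [i.CommShift ℤ]
    [i.Faithful] [NatTrans.CommShift (whiskerRight τ i) ℤ] : NatTrans.CommShift τ ℤ where
  shift_comm a := by
    apply NatTrans.ext
    funext K
    apply i.map_injective
    have key := NatTrans.shift_app_comm (whiskerRight τ i) a K
    have h := (i.commShiftIso a).hom.naturality (τ.app K)
    simp only [commShiftIso_comp_hom_app, whiskerRight_app, Category.assoc, comp_obj, comp_map]
      at key h
    rw [← h, ← Category.assoc, ← Category.assoc, cancel_mono] at key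
    simpa using key

variable [Preadditive C] [Preadditive D] [Preadditive E]

instance mapHomologicalComplex_natTrans_commShift {F G : C ⥤ D} [F.Additive] [G.Additive]
    (τ : F ⟶ G) : NatTrans.CommShift (NatTrans.mapHomologicalComplex τ (.up ℤ)) ℤ where
  shift_comm a := by
    apply NatTrans.ext
    funext K
    apply HomologicalComplex.hom_ext
    intro n
    -- The shift isomorphisms of both functors are identities in each degree.
    exact (Category.id_comp _).trans (Category.comp_id _).symm

instance mapHomologicalComplexCompIso_commShift (F : C ⥤ D) (G : D ⥤ E) [F.Additive] [G.Additive] :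
    NatTrans.CommShift (mapHomologicalComplexCompIso (Iso.refl (F ⋙ G)) (.up ℤ)).hom ℤ where
  shift_comm a := by
    apply NatTrans.ext
    funext K
    apply HomologicalComplex.hom_ext
    intro n
    rw [NatTrans.comp_app, commShiftIso_comp_hom_app]
    change (G.map (𝟙 _) ≫ 𝟙 _) ≫ 𝟙 _ = 𝟙 _ ≫ 𝟙 _
    simp

/-- The quotient functor is surjective on objects, so compatibility can be tested on complexes. -/
instance mapHomotopyCategory_natTrans_commShift {F G : C ⥤ D} [F.Additive] [G.Additive]
    (τ : F ⟶ G) : NatTrans.CommShift (NatTrans.mapHomotopyCategory τ (.up ℤ)) ℤ := by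
  let Q := HomotopyCategory.quotient C (.up ℤ)
  have e : whiskerLeft Q (NatTrans.mapHomotopyCategory τ (.up ℤ)) =
      (F.mapHomotopyCategoryFactors (.up ℤ)).hom ≫
        whiskerRight (NatTrans.mapHomologicalComplex τ (.up ℤ)) (HomotopyCategory.quotient D _) ≫
        (G.mapHomotopyCategoryFactors (.up ℤ)).inv := by
    ext K
    exact ((Category.id_comp _).trans (Category.comp_id _)).symm
  have : NatTrans.CommShift (whiskerLeft Q (NatTrans.mapHomotopyCategory τ (.up ℤ))) ℤ := by
    rw [e]
    infer_instance
  refine natTrans_commShift_of_whiskerLeft Q _ fun K => ?_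
  obtain ⟨K, rfl⟩ := HomotopyCategory.quotient_obj_surjective K
  exact ⟨K, 𝟙 _, inferInstance⟩

instance mapHomotopyCategoryCompIso_commShift (F : C ⥤ D) (G : D ⥤ E) [F.Additive] [G.Additive] :
    NatTrans.CommShift (mapHomotopyCategoryCompIso (Iso.refl (F ⋙ G)) (.up ℤ)).hom ℤ := by
  let Q := HomotopyCategory.quotient C (.up ℤ)
  have e : whiskerLeft Q (mapHomotopyCategoryCompIso (Iso.refl (F ⋙ G)) (.up ℤ)).hom =
      (associator _ _ _).inv ≫
      whiskerRight (F.mapHomotopyCategoryFactors (.up ℤ)).hom (G.mapHomotopyCategory _) ≫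
      (associator _ _ _).hom ≫
      whiskerLeft (F.mapHomologicalComplex _) (G.mapHomotopyCategoryFactors (.up ℤ)).hom ≫
      (associator _ _ _).inv ≫
      whiskerRight (mapHomologicalComplexCompIso (Iso.refl (F ⋙ G)) (.up ℤ)).hom
        (HomotopyCategory.quotient E _) ≫
      ((F ⋙ G).mapHomotopyCategoryFactors (.up ℤ)).inv := by
    ext K
    change _ = 𝟙 _ ≫ (G.mapHomotopyCategory _).map (𝟙 _) ≫ 𝟙 _ ≫ 𝟙 _ ≫ 𝟙 _ ≫
      (HomotopyCategory.quotient E _).map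
        ((mapHomologicalComplexCompIso (Iso.refl (F ⋙ G)) (.up ℤ)).hom.app K) ≫ 𝟙 _
    simp only [Category.id_comp]
    refine ((congrArg (fun a => a ≫ _) ((G.mapHomotopyCategory _).map_id _)).trans ?_).symm
    exact (Category.id_comp _).trans (Category.comp_id _)
  have : NatTrans.CommShift
      (whiskerLeft Q (mapHomotopyCategoryCompIso (Iso.refl (F ⋙ G)) (.up ℤ)).hom) ℤ := by
    rw [e]
    infer_instance
  refine natTrans_commShift_of_whiskerLeft Q _ fun K => ?_
  obtain ⟨K, rfl⟩ := HomotopyCategory.quotient_obj_surjective K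
  exact ⟨K, 𝟙 _, inferInstance⟩

/-- The functor `F.mapHomotopyCategoryPlus` is induced by `F.mapHomotopyCategory`. -/
def mapHomotopyCategoryPlusCompι (F : C ⥤ D) [F.Additive] :
    F.mapHomotopyCategoryPlus ⋙ HomotopyCategory.Plus.ι D ≅
      HomotopyCategory.Plus.ι C ⋙ F.mapHomotopyCategory (.up ℤ) :=
  ObjectProperty.liftCompιIso ..

instance (F : C ⥤ D) [F.Additive] : NatTrans.CommShift (mapHomotopyCategoryPlusCompι F).hom ℤ :=
  inferInstanceAs (NatTrans.CommShift (ObjectProperty.liftCompιIso ..).hom ℤ)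

end

section

variable {C D E : Type*} [Category* C] [Category* D] [Category* E]
  [Abelian C] [Abelian D] [Abelian E]

instance natTransMapHomotopyCategoryPlus_commShift {F G : C ⥤ D} [F.Additive] [G.Additive]
    (τ : F ⟶ G) : NatTrans.CommShift (natTransMapHomotopyCategoryPlus τ) ℤ := by
  have e : whiskerRight (natTransMapHomotopyCategoryPlus τ) (HomotopyCategory.Plus.ι D) =
      (mapHomotopyCategoryPlusCompι F).hom ≫
        whiskerLeft (HomotopyCategory.Plus.ι C) (NatTrans.mapHomotopyCategory τ (.up ℤ)) ≫
        (mapHomotopyCategoryPlusCompι G).inv := by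
    ext K
    exact ((Category.id_comp _).trans (Category.comp_id _)).symm
  have : NatTrans.CommShift (whiskerRight (natTransMapHomotopyCategoryPlus τ)
      (HomotopyCategory.Plus.ι D)) ℤ := by
    rw [e]
    infer_instance
  exact natTrans_commShift_of_whiskerRight _ (HomotopyCategory.Plus.ι D)

instance mapHomotopyCategoryPlusCompIso_commShift (F : C ⥤ D) (G : D ⥤ E)
    [F.Additive] [G.Additive] :
    NatTrans.CommShift (mapHomotopyCategoryPlusCompIso (Iso.refl (F ⋙ G))).hom ℤ := by
  have e : whiskerRight (mapHomotopyCategoryPlusCompIso (Iso.refl (F ⋙ G))).hom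
      (HomotopyCategory.Plus.ι E) =
      (associator _ _ _).hom ≫
      whiskerLeft F.mapHomotopyCategoryPlus (mapHomotopyCategoryPlusCompι G).hom ≫
      (associator _ _ _).inv ≫
      whiskerRight (mapHomotopyCategoryPlusCompι F).hom (G.mapHomotopyCategory (.up ℤ)) ≫
      (associator _ _ _).hom ≫
      whiskerLeft (HomotopyCategory.Plus.ι C)
        (mapHomotopyCategoryCompIso (Iso.refl (F ⋙ G)) (.up ℤ)).hom ≫
      (mapHomotopyCategoryPlusCompι (F ⋙ G)).inv := by
    ext K
    change _ = 𝟙 _ ≫ 𝟙 _ ≫ 𝟙 _ ≫ (G.mapHomotopyCategory _).map (𝟙 _) ≫ 𝟙 _ ≫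
      (mapHomotopyCategoryCompIso (Iso.refl (F ⋙ G)) (.up ℤ)).hom.app K.obj ≫ 𝟙 _
    simp only [map_id, Category.id_comp, Category.comp_id]
    rfl
  have : NatTrans.CommShift (whiskerRight (mapHomotopyCategoryPlusCompIso (Iso.refl (F ⋙ G))).hom
      (HomotopyCategory.Plus.ι E)) ℤ := by
    rw [e]
    infer_instance
  exact natTrans_commShift_of_whiskerRight _ (HomotopyCategory.Plus.ι E)

end

/-! ### Comparison morphisms tested on complexes of injectives. -/

variable {C D E : Type*} [Category* C] [Category* D] [Category* E]
  [Abelian C] [Abelian D] [Abelian E]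
  [HasDerivedCategory C] [HasDerivedCategory D] [HasDerivedCategory E] [EnoughInjectives C]

/-- A natural transformation on the bounded below derived category is an isomorphism if it is
so on complexes of injective objects. -/
lemma isIso_of_isIso_app_injectives {H : Type*} [Category* H] {G₁ G₂ : DerivedCategory.Plus C ⥤ H}
    (τ : G₁ ⟶ G₂) (h : ∀ K : HomotopyCategory.Plus (InjectiveObject C),
      IsIso (τ.app ((injectivesToDerivedPlus C).obj K))) : IsIso τ := by
  rw [NatTrans.isIso_iff_isIso_app]
  intro M
  rw [← NatTrans.isIso_app_iff_of_iso τ ((injectivesToDerivedPlus C).objObjPreimageIso M)]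
  exact h _

lemma rightDerivedPlusNatTrans_fac {F G : C ⥤ D} [F.Additive] [G.Additive] (τ : F ⟶ G) :
    F.rightDerivedFunctorPlusUnit ≫ whiskerLeft DerivedCategory.Plus.Qh
      (rightDerivedPlusNatTrans τ) =
    whiskerRight (natTransMapHomotopyCategoryPlus τ) DerivedCategory.Plus.Qh ≫
      G.rightDerivedFunctorPlusUnit :=
  rightDerivedNatTrans_fac _ _ _ _ _ _

lemma rightDerivedPlusComp_fac [EnoughInjectives D] (F : C ⥤ D) (G : D ⥤ E)
    [F.Additive] [G.Additive] :
    (F ⋙ G).rightDerivedFunctorPlusUnit ≫ whiskerLeft DerivedCategory.Plus.Qh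
      (rightDerivedPlusComp F G) =
    whiskerRight (mapHomotopyCategoryPlusCompIso (Iso.refl (F ⋙ G))).inv DerivedCategory.Plus.Qh ≫
      (associator _ _ _).hom ≫
      whiskerLeft F.mapHomotopyCategoryPlus G.rightDerivedFunctorPlusUnit ≫
      (associator _ _ _).inv ≫
      whiskerRight F.rightDerivedFunctorPlusUnit G.rightDerivedFunctorPlus ≫
      (associator _ _ _).hom := by
  refine (rightDerived_fac _ _ _ _ _).trans ?_
  ext K
  simp

/-- On complexes of injectives the unit is invertible, so there `τ` is `β` up to isomorphisms
compatible with the shift; these complexes exhaust the bounded below derived category. -/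
lemma natTrans_commShift_of_fac {F : C ⥤ D} [F.Additive]
    {G : DerivedCategory.Plus C ⥤ DerivedCategory.Plus D} [G.CommShift ℤ]
    (τ : F.rightDerivedFunctorPlus ⟶ G)
    (β : F.mapHomotopyCategoryPlus ⋙ DerivedCategory.Plus.Qh ⟶ DerivedCategory.Plus.Qh ⋙ G)
    [NatTrans.CommShift β ℤ]
    (h : F.rightDerivedFunctorPlusUnit ≫ whiskerLeft DerivedCategory.Plus.Qh τ = β) :
    NatTrans.CommShift τ ℤ := by
  have e : whiskerLeft (injectivesToDerivedPlus C) τ =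
      (rightDerivedFunctorPlusInjectivesIso F).hom ≫
        whiskerLeft (InjectiveObject.ι C).mapHomotopyCategoryPlus β ≫ (associator _ _ _).inv := by
    rw [← Iso.inv_comp_eq, ← h]
    ext K
    exact (Category.comp_id _).symm
  have : NatTrans.CommShift (whiskerLeft (injectivesToDerivedPlus C) τ) ℤ := by
    rw [e]
    infer_instance
  refine natTrans_commShift_of_whiskerLeft (injectivesToDerivedPlus C) _ fun K => ?_
  exact ⟨_, ((injectivesToDerivedPlus C).objObjPreimageIso K).inv, inferInstance⟩

instance rightDerivedPlusNatTrans_commShift {F G : C ⥤ D} [F.Additive] [G.Additive] (τ : F ⟶ G) :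
    NatTrans.CommShift (rightDerivedPlusNatTrans τ) ℤ :=
  natTrans_commShift_of_fac _ _ (rightDerivedPlusNatTrans_fac τ)

instance rightDerivedPlusComp_commShift [EnoughInjectives D] (F : C ⥤ D) (G : D ⥤ E)
    [F.Additive] [G.Additive] : NatTrans.CommShift (rightDerivedPlusComp F G) ℤ :=
  natTrans_commShift_of_fac _ _ (rightDerivedPlusComp_fac F G)

/-- On complexes of injectives both units are invertible, and the remaining map is `τ` in each
degree. -/
lemma isIso_rightDerivedPlusNatTrans {F G : C ⥤ D} [F.Additive] [G.Additive] (τ : F ⟶ G)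
    [IsIso τ] : IsIso (rightDerivedPlusNatTrans τ) := by
  refine isIso_of_isIso_app_injectives _ fun K => ?_
  let I := (InjectiveObject.ι C).mapHomotopyCategoryPlus.obj K
  have e := NatTrans.congr_app (rightDerivedPlusNatTrans_fac τ) I
  have h₀ : IsIso (F.rightDerivedFunctorPlusUnit.app I) := inferInstance
  have h₁ : IsIso (G.rightDerivedFunctorPlusUnit.app I) := inferInstance
  have h₂ : IsIso ((natTransMapHomotopyCategoryPlus τ).app I) := by
    have h : IsIso ((NatTrans.mapHomologicalComplex τ (.up ℤ)).app I.obj.as) := by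
      have : ∀ n, IsIso (((NatTrans.mapHomologicalComplex τ (.up ℤ)).app I.obj.as).f n) :=
        fun n => inferInstanceAs (IsIso (τ.app (I.obj.as.X n)))
      exact HomologicalComplex.Hom.isIso_of_components _
    have : IsIso ((HomotopyCategory.Plus.ι D).map ((natTransMapHomotopyCategoryPlus τ).app I)) :=
      inferInstanceAs (IsIso ((HomotopyCategory.quotient D _).map
        ((NatTrans.mapHomologicalComplex τ (.up ℤ)).app I.obj.as)))
    exact isIso_of_reflects_iso _ (HomotopyCategory.Plus.ι D)
  have h₃ : IsIso (DerivedCategory.Plus.Qh.map ((natTransMapHomotopyCategoryPlus τ).app I)) :=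
    inferInstance
  have h₄ := (congrArg (fun a => IsIso a) e).mpr (@IsIso.comp_isIso _ _ _ _ _ _ _ h₃ h₁)
  exact @IsIso.of_isIso_comp_left _ _ _ _ _ _ _ h₀ h₄

/-- The form of `h` replaces the usual demand that `F` send injectives to `G`-acyclic objects: in
the factorization on injectives, the unit of `RG` is the only map not already known to be
invertible. -/
lemma isIso_rightDerivedPlusComp [EnoughInjectives D] (F : C ⥤ D) (G : D ⥤ E)
    [F.Additive] [G.Additive]
    (h : ∀ K : HomotopyCategory.Plus (InjectiveObject C), IsIso (G.rightDerivedFunctorPlusUnit.app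
      (F.mapHomotopyCategoryPlus.obj ((InjectiveObject.ι C).mapHomotopyCategoryPlus.obj K)))) :
    IsIso (rightDerivedPlusComp F G) := by
  refine isIso_of_isIso_app_injectives _ fun K => ?_
  let I := (InjectiveObject.ι C).mapHomotopyCategoryPlus.obj K
  have e : (F ⋙ G).rightDerivedFunctorPlusUnit.app I ≫
      (rightDerivedPlusComp F G).app (DerivedCategory.Plus.Qh.obj I) =
      DerivedCategory.Plus.Qh.map ((mapHomotopyCategoryPlusCompIso (Iso.refl (F ⋙ G))).inv.app I) ≫
      G.rightDerivedFunctorPlusUnit.app (F.mapHomotopyCategoryPlus.obj I) ≫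
      G.rightDerivedFunctorPlus.map (F.rightDerivedFunctorPlusUnit.app I) :=
    rightDerived_fac_app _ _ _ _ _ I
  have h₀ : IsIso ((F ⋙ G).rightDerivedFunctorPlusUnit.app I) := inferInstance
  have h₁ : IsIso (F.rightDerivedFunctorPlusUnit.app I) := inferInstance
  have h₂ : IsIso (G.rightDerivedFunctorPlus.map (F.rightDerivedFunctorPlusUnit.app I)) :=
    inferInstance
  have h₃ := h K
  have h₄ : IsIso (DerivedCategory.Plus.Qh.map
    ((mapHomotopyCategoryPlusCompIso (Iso.refl (F ⋙ G))).inv.app I)) := inferInstance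
  have h₅ := @IsIso.comp_isIso _ _ _ _ _ _ _ h₄ (@IsIso.comp_isIso _ _ _ _ _ _ _ h₃ h₂)
  rw [← e] at h₅
  exact @IsIso.of_isIso_comp_left _ _ _ _ _ _ _ h₀ h₅

end CategoryTheory.Functor

/-! ### Derived proper base change. -/

namespace Sh

variable {W X Y Z : TopCat.{u}}

/-- All sheaves are adapted to the inverse image functor. -/
lemma isAdapted_inverseImage (p : Z ⟶ X) :
    (⊤ : ObjectProperty (Sh X)).IsAdapted (inverseImage p) where
  of_injective _ _ := trivial
  biprod _ _ := trivial
  of_shortExact _ _ _ := trivial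
  map_shortExact hS _ := inverseImage_map_shortExact p hS

/-- The sheaves which are soft on the fibers of a separated and locally proper map are adapted to
the proper direct image functor. -/
lemma isAdapted_properDirectImage {g : W ⟶ Z} (hg : IsSeparatedMap g) (hg' : IsLocallyProper g) :
    (IsSoftOnFibers g).IsAdapted (properDirectImage g) where
  of_injective I _ := isSoftOnFibers_of_injective hg hg' I
  biprod := isSoftOnFibers_biprod
  of_shortExact hS := isSoftOnFibers_of_shortExact hg hg' hS
  map_shortExact hS := properDirectImage_map_shortExact hg hg' hS

lemma isIso_rightDerivedPlusComp_inverseImage [HasDerivedCategory.{w₂} (Sh X)]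
    [HasDerivedCategory.{w₃} (Sh Y)] [HasDerivedCategory.{w₄} (Sh Z)] (f : Y ⟶ X) (p : Z ⟶ X) :
    IsIso (Functor.rightDerivedPlusComp (properDirectImage f) (inverseImage p)) :=
  Functor.isIso_rightDerivedPlusComp _ _ fun _ =>
    (isAdapted_inverseImage p).isIso_rightDerivedFunctorPlusUnit_app fun _ => trivial

lemma isIso_rightDerivedPlusComp_properDirectImage [HasDerivedCategory.{w₁} (Sh W)]
    [HasDerivedCategory.{w₃} (Sh Y)] [HasDerivedCategory.{w₄} (Sh Z)] {f : Y ⟶ X} {g : W ⟶ Z} {p : Z ⟶ X} {q : W ⟶ Y}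
    (sq : IsPullback q g f p) (hf : IsSeparatedMap f) (hg : IsSeparatedMap g)
    (hg' : IsLocallyProper g) :
    IsIso (Functor.rightDerivedPlusComp (inverseImage q) (properDirectImage g)) :=
  Functor.isIso_rightDerivedPlusComp _ _ fun K =>
    (isAdapted_properDirectImage hg hg').isIso_rightDerivedFunctorPlusUnit_app fun n =>
      isSoftOnFibers_inverseImage_of_injective sq hf hg'
        (((InjectiveObject.ι (Sh Y)).mapHomotopyCategoryPlus.obj K).obj.as.X n)

end Sh

theorem theoremt {W X Y Z : TopCat.{u}}
    [HasDerivedCategory.{w₁} (Sh W)] [HasDerivedCategory.{w₂} (Sh X)]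
    [HasDerivedCategory.{w₃} (Sh Y)] [HasDerivedCategory.{w₄} (Sh Z)]
    (f : Y ⟶ X) (g : W ⟶ Z) (p : Z ⟶ X) (q : W ⟶ Y) (sq : IsPullback q g f p)
    (hf : IsSeparatedMap f) (hf' : IsLocallyProper f)
    (hg : IsSeparatedMap g) (hg' : IsLocallyProper g) :
    IsTriangulatedIso
      (Functor.rightDerivedPlusComp (Sh.properDirectImage f) (Sh.inverseImage p)) ∧
    IsTriangulatedIso
      (Functor.rightDerivedPlusComp (Sh.inverseImage q) (Sh.properDirectImage g)) ∧
    ∃ θ : Sh.derivedProperDirectImage f ⋙ Sh.derivedInverseImage p ⟶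
        Sh.derivedInverseImage q ⋙ Sh.derivedProperDirectImage g,
      IsTriangulatedIso θ ∧
      Functor.rightDerivedPlusComp (Sh.properDirectImage f) (Sh.inverseImage p) ≫ θ =
        Functor.rightDerivedPlusNatTrans (Sh.baseChange sq) ≫
          Functor.rightDerivedPlusComp (Sh.inverseImage q) (Sh.properDirectImage g) := by
  have h₁ := Sh.isIso_rightDerivedPlusComp_inverseImage f p
  have h₂ := Sh.isIso_rightDerivedPlusComp_properDirectImage sq hf hg hg'
  have := Sh.isIso_baseChange sq hf hf' hg'
  have h₃ := Functor.isIso_rightDerivedPlusNatTrans (Sh.baseChange sq)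
  -- Needed because `θ` contains the inverse of this comparison morphism: the required triangle
  -- leaves no other choice for `θ`.
  have h₄ := NatTrans.CommShift.of_isIso
    (Functor.rightDerivedPlusComp (Sh.properDirectImage f) (Sh.inverseImage p)) ℤ
  refine ⟨⟨inferInstance, inferInstance, inferInstance, h₁⟩,
    ⟨inferInstance, inferInstance, inferInstance, h₂⟩,
    inv (Functor.rightDerivedPlusComp (Sh.properDirectImage f) (Sh.inverseImage p)) ≫
      Functor.rightDerivedPlusNatTrans (Sh.baseChange sq) ≫
        Functor.rightDerivedPlusComp (Sh.inverseImage q) (Sh.properDirectImage g),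
    ⟨inferInstance, inferInstance, inferInstance, inferInstance⟩, IsIso.hom_inv_id_assoc _ _⟩
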